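/- Let $K$ be a field. A Frobenius pair $(C,l_C)$ is a finite-dimensional associative unital $K$-algebra $C$ with a linear form $l_C$ such that $(x,y)_C=l_C(xy)$ is symmetric and non-degenerate. An equipped Cardy–Frobenius algebra $((A,l_A),(B,l_B),\phi,U,\star)$ over $K$ consists of: a commutative Frobenius pair $(A,l_A)$; a Frobenius pair $(B,l_B)$; a homomorphism of unital algebras $\phi:A\to B$ with image in the centre of $B$ satisfying the Cardy condition $(\phi^*(b'),\phi^*(b''))_A=\mathrm{Tr}_B(b\mapsto b'bb'')$ for all $b',b''\in B$, where $\phi^*:B\to A$ is the adjoint of $\phi$; $K$-linear involutive anti-automorphisms $\star$ of $A$ and of $B$ with $l_A(x^\star)=l_A(x)$, $l_B(x^\star)=l_B(x)$, $\phi(x^\star)=\phi(x)^\star$; and an element $U\in A$ with $U^2=K_A^\star$ and $\phi(U)=K_B^\star$. Here, for $C=A,B$, $K_C^\star=\sum_{i,j}F^{ij}\gamma_i\gamma_j^\star$, where $(\gamma_i)$ is a basis of $C$ and $(F^{ij})$ is the inverse of the matrix $(l_C(\gamma_i\gamma_j))$. It is called semi-simple if the algebras $A$ and $B$ are semi-simple,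 and simple if it is semi-simple, non-zero, and not isomorphic to a direct sum of two non-zero equipped Cardy–Frobenius algebras (direct sums are taken componentwise, with the linear forms added; isomorphisms respect all the data). A complex (equipped) Cardy–Frobenius algebra is pseudoreal if $A=A_R\otimes_{\mathbb R}\mathbb C$, $B=B_R\otimes_{\mathbb R}\mathbb C$, $\phi=\phi_R\otimes\mathbb C$ for some real algebras $A_R,B_R$ and a homomorphism $\phi_R:A_R\to B_R$. For $\mathbb D\in\{\mathbb R,\mathbb C,\mathbb H\}$, $d=\dim_{\mathbb R}\mathbb D$, an integer $n\ge 1$ and $\mu\in\mathbb C\setminus\{0\}$, let $H^{\mathbb D}_{n,\mu}\otimes\mathbb C$ be the complexification of the following data: $A_R=Z(\mathbb D)$, $l_{A_R}(a)=\mu^2\,\mathrm{Re}(a)/d$; $B_R=\mathrm{Mat}_n(\mathbb D)$, $l_{B_R}(x)=\mu\,\mathrm{Re}\,\mathrm{Tr}(x)$; $\phi_R(a)=a\,\mathrm{Id}$; $a^\star=\bar a$, $x^\star=\bar x^{\,t}$; $U=(2-d)/\mu$. (The forms are complex-valued; forms, homomorphism and involutions are extended $\mathbb C$-linearly to $A=A_R\otimes\mathbb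 C$ and $B=B_R\otimes\mathbb C$, and $U=\frac{2-d}{\mu}\cdot 1\in A$.) **Theorem.** Every semi-simple equipped Cardy–Frobenius algebra $((A,l_A),(B,l_B),\phi,U,\star)$ over $\mathbb C$ is isomorphic to a direct sum of finitely many $H^{\mathbb D_i}_{n_i,\mu_i}\otimes\mathbb C$, with $\mathbb D_i\in\{\mathbb R,\mathbb C,\mathbb H\}$, $n_i\ge1$, $\mu_i\in\mathbb C\setminus\{0\}$, and of $\mathrm{Ker}(\phi)$, by an isomorphism that restricts to the identity from $\mathrm{Ker}(\phi)\subset A$ onto the last summand. Here $\mathrm{Ker}(\phi)=eA$, with $e$ the idempotent that is its unit, is regarded as the summand whose first algebra is $\mathrm{Ker}(\phi)$ with the restrictions of $l_A$ and $\star$ and the element $eU$, and whose second algebra is $0$. Moreover, every simple equipped Cardy–Frobenius algebra over $\mathbb C$ is pseudoreal. -/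

import Mathlib

open scoped TensorProduct Quaternion

set_option linter.checkUnivs false

universe u v u₁ v₁ u₂ v₂ w

noncomputable section

namespace CardyFrobenius

/-- The twisted Casimir element `∑ᵢⱼ Fⁱʲ • βᵢ * s(βⱼ)` of a finite-dimensional algebra `V` with
linear form `l` and linear map `s`, where `(βᵢ)` is a basis of `V` and `(Fⁱʲ)` is the inverse of the
Gram matrix `(l(βᵢ βⱼ))`. For a non-degenerate form it does not depend on the basis. -/
def casimir {K : Type*} {V : Type*} [Field K] [Ring V] [Algebra K V]
    [Module.Finite K V] (l : V →ₗ[K] K) (s : V →ₗ[K] V) : V :=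
  let β := Module.finBasis K V
  let F := (Matrix.of fun i j => l (β i * β j))⁻¹
  ∑ i, ∑ j, F i j • (β i * s (β j))

/-- The operator `b ↦ b' * b * b''` on an algebra. -/
def sandwich (K : Type*) {V : Type*} [Field K] [Ring V] [Algebra K V] (b' b'' : V) : V →ₗ[K] V :=
  (LinearMap.mulLeft K b') ∘ₗ (LinearMap.mulRight K b'')

/-- The underlying data `((A, l_A), (B, l_B), φ, U, ⋆)` of an equipped Cardy–Frobenius algebra over
`K`, without the axioms. -/
structure EquippedData (K : Type w) [Field K] where
  A : Type u
  B : Type v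
  [commRingA : CommRing A]
  [ringB : Ring B]
  [algebraA : Algebra K A]
  [algebraB : Algebra K B]
  lA : A →ₗ[K] K
  lB : B →ₗ[K] K
  φ : A →ₐ[K] B
  U : A
  starA : A →ₗ[K] A
  starB : B →ₗ[K] B

attribute [instance] EquippedData.commRingA EquippedData.ringB
  EquippedData.algebraA EquippedData.algebraB

/-- An equipped Cardy–Frobenius algebra over the field `K`. -/
structure EquippedCFAlgebra (K : Type w) [Field K] extends EquippedData.{u, v, w} K where
  [finiteA : Module.Finite K A]
  [finiteB : Module.Finite K B]
  /-- `(A, l_A)` is a commutative Frobenius pair. -/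
  nondegA : ∀ x : A, (∀ y : A, lA (x * y) = 0) → x = 0
  /-- `(B, l_B)` is a Frobenius pair: the form `l_B(xy)` is symmetric and non-degenerate. -/
  symmB : ∀ x y : B, lB (x * y) = lB (y * x)
  nondegB : ∀ x : B, (∀ y : B, lB (x * y) = 0) → x = 0
  /-- The image of `φ` lies in the centre of `B`. -/
  central : ∀ (a : A) (b : B), φ a * b = b * φ a
  /-- The Cardy condition. Here `φdual` is the adjoint `φ^*` of `φ` for the two Frobenius forms,
  which exists and is unique by non-degeneracy. -/
  cardy : ∃ φdual : B →ₗ[K] A,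
    (∀ (b : B) (a : A), lA (φdual b * a) = lB (b * φ a)) ∧
    ∀ b' b'' : B, lA (φdual b' * φdual b'') = LinearMap.trace K B (sandwich K b' b'')
  /-- `⋆` is an involutive anti-automorphism of `A` and of `B`, compatible with `l_A`, `l_B`, `φ`. -/
  starA_starA : ∀ x : A, starA (starA x) = x
  starB_starB : ∀ x : B, starB (starB x) = x
  starA_mul : ∀ x y : A, starA (x * y) = starA y * starA x
  starB_mul : ∀ x y : B, starB (x * y) = starB y * starB x
  lA_star : ∀ x : A, lA (starA x) = lA x
  lB_star : ∀ x : B, lB (starB x) = lB x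
  φ_star : ∀ x : A, φ (starA x) = starB (φ x)
  /-- `U² = K_A^⋆` and `φ(U) = K_B^⋆`. -/
  U_sq : U ^ 2 = casimir lA starA
  φ_U : φ U = casimir lB starB

variable {K : Type w} [Field K]

/-- Isomorphisms of equipped Cardy–Frobenius algebras. -/
structure EquippedData.Iso (H : EquippedData.{u₁, v₁, w} K) (H' : EquippedData.{u₂, v₂, w} K) where
  equivA : H.A ≃ₐ[K] H'.A
  equivB : H.B ≃ₐ[K] H'.B
  map_lA : ∀ x, H'.lA (equivA x) = H.lA x
  map_lB : ∀ x, H'.lB (equivB x) = H.lB x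
  map_φ : ∀ x, equivB (H.φ x) = H'.φ (equivA x)
  map_U : equivA H.U = H'.U
  map_starA : ∀ x, equivA (H.starA x) = H'.starA (equivA x)
  map_starB : ∀ x, equivB (H.starB x) = H'.starB (equivB x)

/-- The direct sum of two equipped Cardy–Frobenius algebras. -/
def EquippedData.prod (H : EquippedData.{u₁, v₁, w} K) (H' : EquippedData.{u₂, v₂, w} K) :
    EquippedData.{max u₁ u₂, max v₁ v₂, w} K where
  A := H.A × H'.A
  B := H.B × H'.B
  lA := H.lA.coprod H'.lA
  lB := H.lB.coprod H'.lB
  φ := H.φ.prodMap H'.φ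
  U := (H.U, H'.U)
  starA := H.starA.prodMap H'.starA
  starB := H.starB.prodMap H'.starB

/-- The direct sum of a finite family of equipped Cardy–Frobenius algebras. -/
def EquippedData.directSum {k : ℕ} (F : Fin k → EquippedData.{u, v, w} K) :
    EquippedData.{u, v, w} K where
  A := ∀ i, (F i).A
  B := ∀ i, (F i).B
  lA := ∑ i, (F i).lA ∘ₗ LinearMap.proj i
  lB := ∑ i, (F i).lB ∘ₗ LinearMap.proj i
  φ := AlgHom.pi fun i => (F i).φ.comp (Pi.evalAlgHom K _ i)
  U := fun i => (F i).U
  starA := LinearMap.pi fun i => (F i).starA ∘ₗ LinearMap.proj i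
  starB := LinearMap.pi fun i => (F i).starB ∘ₗ LinearMap.proj i

namespace EquippedCFAlgebra

/-- Semi-simplicity: both algebras `A` and `B` are semi-simple. -/
structure IsSemisimple (H : EquippedCFAlgebra.{u, v, w} K) : Prop where
  semisimpleA : IsSemisimpleRing H.A
  semisimpleB : IsSemisimpleRing H.B

/-- The zero equipped Cardy–Frobenius algebra. -/
def IsZero (H : EquippedCFAlgebra.{u, v, w} K) : Prop :=
  Subsingleton H.A ∧ Subsingleton H.B

/-- `H` is simple if it is semi-simple, non-zero and not a direct sum of two non-zero equipped
Cardy–Frobenius algebras. -/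
def IsSimple (H : EquippedCFAlgebra.{u, v, w} K) : Prop :=
  H.IsSemisimple ∧ ¬ H.IsZero ∧
    ∀ H₁ H₂ : EquippedCFAlgebra.{u, v, w} K,
      Nonempty (H.toEquippedData.Iso (H₁.toEquippedData.prod H₂.toEquippedData)) →
        H₁.IsZero ∨ H₂.IsZero

/-- A complex algebra is pseudoreal if `A`, `B` and `φ` are the complexifications of real algebras
and of a homomorphism between them. -/
def IsPseudoreal (H : EquippedCFAlgebra.{u, v, 0} ℂ) : Prop :=
  ∃ (AR : Type u) (BR : Type v) (_ : Ring AR) (_ : Ring BR) (_ : Algebra ℝ AR) (_ : Algebra ℝ BR)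
    (φR : AR →ₐ[ℝ] BR) (eA : ℂ ⊗[ℝ] AR ≃ₐ[ℂ] H.A) (eB : ℂ ⊗[ℝ] BR ≃ₐ[ℂ] H.B),
    ∀ x : ℂ ⊗[ℝ] AR,
      H.φ (eA x) = eB (Algebra.TensorProduct.map (AlgHom.id ℂ ℂ) φR x)

section Kernel

variable (H : EquippedCFAlgebra.{u, v, w} K)

/-- The underlying space of the ideal `Ker φ` of `A`. -/
def Ker : Type u := RingHom.ker H.φ

instance : AddCommGroup H.Ker := inferInstanceAs (AddCommGroup (RingHom.ker H.φ))

instance : Module K H.Ker := inferInstanceAs (Module K ((RingHom.ker H.φ).restrictScalars K))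

/-- The inclusion of `Ker φ` into `A`. -/
def kerIncl : H.Ker →ₗ[K] H.A := ((RingHom.ker H.φ).restrictScalars K).subtype

lemma kerIncl_injective : Function.Injective H.kerIncl := Subtype.val_injective

lemma φ_kerIncl (x : H.Ker) : H.φ (H.kerIncl x) = 0 := x.2

/-- Elements of `A` killed by `φ`, as elements of `Ker φ`. -/
def kerMk (a : H.A) (h : H.φ a = 0) : H.Ker := ⟨a, h⟩

@[simp] lemma kerIncl_kerMk (a : H.A) (h : H.φ a = 0) : H.kerIncl (H.kerMk a h) = a := rfl

variable {H}

lemma IsSemisimple.exists_ker_unit (hH : H.IsSemisimple) :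
    ∃ e : H.Ker, ∀ x : H.Ker, H.kerIncl e * H.kerIncl x = H.kerIncl x := by
  have := hH.semisimpleA
  obtain ⟨e, he, hI⟩ := IsSemisimpleRing.ideal_eq_span_idempotent (RingHom.ker H.φ)
  have hmem : e ∈ RingHom.ker H.φ := by
    rw [hI]; exact Ideal.mem_span_singleton_self e
  refine ⟨H.kerMk e (RingHom.mem_ker.mp hmem), fun x => ?_⟩
  have hx : H.kerIncl x ∈ RingHom.ker H.φ := x.2
  rw [hI, Ideal.mem_span_singleton] at hx
  obtain ⟨c, hc⟩ := hx
  change e * H.kerIncl x = H.kerIncl x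
  rw [hc, ← mul_assoc, he.eq]

/-- The unit of the algebra `Ker φ` (the ideal `Ker φ` of the semi-simple commutative algebra `A` is
generated by an idempotent). -/
def kerUnit (hH : H.IsSemisimple) : H.Ker := hH.exists_ker_unit.choose

lemma kerUnit_mul (hH : H.IsSemisimple) (x : H.Ker) :
    H.kerIncl (kerUnit hH) * H.kerIncl x = H.kerIncl x :=
  hH.exists_ker_unit.choose_spec x

/-- `Ker φ` is a commutative algebra under the multiplication of `A`, with its own unit. -/
@[reducible] def kerCommRing (hH : H.IsSemisimple) : CommRing H.Ker :=
  { (inferInstance : AddCommGroup H.Ker) with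
    mul := fun x y => H.kerMk (H.kerIncl x * H.kerIncl y) (by rw [map_mul, φ_kerIncl, zero_mul])
    one := kerUnit hH
    mul_assoc := fun x y z => H.kerIncl_injective (mul_assoc _ _ _)
    one_mul := fun x => H.kerIncl_injective (kerUnit_mul hH x)
    mul_one := fun x => H.kerIncl_injective ((mul_comm _ _).trans (kerUnit_mul hH x))
    left_distrib := fun x y z => H.kerIncl_injective (mul_add _ _ _)
    right_distrib := fun x y z => H.kerIncl_injective (add_mul _ _ _)
    zero_mul := fun x => H.kerIncl_injective (zero_mul _)
    mul_zero := fun x => H.kerIncl_injective (mul_zero _)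
    mul_comm := fun x y => H.kerIncl_injective (mul_comm _ _) }

/-- `Ker φ` as a `K`-algebra. -/
@[reducible] def kerAlgebra (hH : H.IsSemisimple) :
    @Algebra K H.Ker _ (kerCommRing hH).toCommSemiring.toSemiring :=
  letI := kerCommRing hH
  Algebra.ofModule
    (fun r x y => H.kerIncl_injective (Algebra.smul_mul_assoc r (H.kerIncl x) (H.kerIncl y)))
    (fun r x y => H.kerIncl_injective (Algebra.mul_smul_comm r (H.kerIncl x) (H.kerIncl y)))

/-- The involution of `A` restricted to `Ker φ`. -/
def kerStar (H : EquippedCFAlgebra.{u, v, w} K) : H.Ker →ₗ[K] H.Ker where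
  toFun x := H.kerMk (H.starA (H.kerIncl x)) (by rw [H.φ_star, φ_kerIncl, map_zero])
  map_add' x y := H.kerIncl_injective (by simp)
  map_smul' r x := H.kerIncl_injective (by simp)

/-- The direct summand `Ker φ` of a semi-simple equipped Cardy–Frobenius algebra: the pair
`(Ker φ, l_A|)` with the restricted involution, the zero algebra in place of `B`, and the component
`e U` of `U` in `Ker φ`, where `e` is the unit of `Ker φ`. -/
def kernelSummand (H : EquippedCFAlgebra.{u, v, w} K) (hH : H.IsSemisimple) :
    EquippedData.{u, v, w} K :=
  letI := kerCommRing hH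
  letI := kerAlgebra hH
  { A := H.Ker
    B := PUnit.{v + 1}
    lA :=
      { toFun := fun x => H.lA (H.kerIncl x)
        map_add' := fun x y => (H.lA ∘ₗ H.kerIncl).map_add x y
        map_smul' := fun r x => (H.lA ∘ₗ H.kerIncl).map_smul r x }
    lB := 0
    φ :=
      { toFun := fun _ => 0
        map_one' := rfl
        map_mul' := fun _ _ => rfl
        map_zero' := rfl
        map_add' := fun _ _ => rfl
        commutes' := fun _ => rfl }
    U := H.kerMk (H.kerIncl (kerUnit hH) * H.U) (by rw [map_mul, φ_kerIncl, zero_mul])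
    starA :=
      { toFun := kerStar H
        map_add' := (kerStar H).map_add
        map_smul' := (kerStar H).map_smul }
    starB := 0 }

end Kernel

end EquippedCFAlgebra

section Models

variable (D : Type) [Ring D] [Algebra ℝ D] [StarRing D] [StarModule ℝ D]

/-- Conjugation on the centre of `D`, as a real linear map. -/
def centerConj : Subalgebra.center ℝ D →ₗ[ℝ] Subalgebra.center ℝ D where
  toFun a := ⟨star (a : D), Set.star_mem_center a.2⟩
  map_add' a b := Subtype.ext (star_add (a : D) b)
  map_smul' r a := Subtype.ext (by simp)

/-- `x ↦ x̄ᵗ` on `Mat_n(D)`, as a real linear map. -/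
def matrixConj (n : ℕ) : Matrix (Fin n) (Fin n) D →ₗ[ℝ] Matrix (Fin n) (Fin n) D where
  toFun x := x.conjTranspose
  map_add' x y := Matrix.conjTranspose_add x y
  map_smul' r x := by simp

/-- The complexification `H^D_{n,μ} ⊗ ℂ`, for a real algebra `D` of dimension `d` with conjugation
`star` and real part `re`. Before complexification `A = Z(D)`, `l_A(a) = μ² re(a) / d`,
`B = Mat_n(D)`, `l_B(x) = μ re(Tr x)`, `φ(a) = a Id`, `a^⋆ = ā`, `x^⋆ = x̄ᵗ`, `U = (2 - d) / μ`. As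
`μ` may be complex, the linear forms on the real algebras take values in `ℂ`; they are extended
`ℂ`-linearly, and so are `φ` and `⋆`. -/
def modelOver (re : D →ₗ[ℝ] ℝ) (n : ℕ) (μ : ℂ) : EquippedData.{0, 0, 0} ℂ where
  A := ℂ ⊗[ℝ] Subalgebra.center ℝ D
  B := ℂ ⊗[ℝ] Matrix (Fin n) (Fin n) D
  lA := LinearMap.liftBaseChange ℂ
    ((re ∘ₗ (Subalgebra.center ℝ D).val.toLinearMap).smulRight (μ ^ 2 / (Module.finrank ℝ D : ℂ)))
  lB := LinearMap.liftBaseChange ℂ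
    ((re ∘ₗ Matrix.traceLinearMap (Fin n) ℝ D).smulRight μ)
  φ := Algebra.TensorProduct.map (AlgHom.id ℂ ℂ)
    ((Matrix.scalarAlgHom (Fin n) ℝ).comp (Subalgebra.center ℝ D).val)
  U := ((2 - (Module.finrank ℝ D : ℂ)) / μ) ⊗ₜ[ℝ] 1
  starA := (centerConj D).baseChange ℂ
  starB := (matrixConj D n).baseChange ℂ

end Models

instance : StarModule ℝ ℍ[ℝ] := ⟨fun r x => by rw [Quaternion.star_smul, star_trivial r]⟩

/-- The names of the three real division algebras `ℝ`, `ℂ`, `ℍ`. -/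
inductive DivisionType : Type
  | real
  | complex
  | quaternion

/-- The complexified model algebra `H^𝔻_{n,μ} ⊗ ℂ` for `𝔻 = ℝ, ℂ, ℍ`. -/
def model : DivisionType → ℕ → ℂ → EquippedData.{0, 0, 0} ℂ
  | .real, n, μ => modelOver ℝ LinearMap.id n μ
  | .complex, n, μ => modelOver ℂ Complex.reLm n μ
  | .quaternion, n, μ => modelOver ℍ[ℝ] (QuaternionAlgebra.reₗ (-1) 0 (-1)) n μ

end CardyFrobenius

end

/-! The data (B, l_B, ⋆), together with the summand Ker φ, determine everything else. If x, y are
dual families for l_B, expanding the trace in the Cardy condition and using non-degeneracy gives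
φ(φ^*(b)) = Σ yᵢ b xᵢ (`exists_φ_eq_average`). For semi-simple B these averages fill the centre
(`centerEqAverages_of_blocks`), so φ maps A onto Z(B), and A splits as Z(B) × Ker φ. On the first
factor, l_A is forced by l_A(φ^*(b)) = l_B(b), as φ^*(b) is orthogonal to Ker φ; U is forced by φ(U)
= K_B^⋆, and ⋆ by φ(a^⋆) = φ(a)^⋆. The models and their direct sums obey the same rules
(`EquippedData.IsCentral`), so an isomorphism of the B-parts extends to the whole data
(`exists_iso_prod_kernelSummand`).

It remains to classify algebras B with form and involution (`exists_model_decomposition`). Over ℂ, B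
is a product of matrix algebras and ⋆ permutes the blocks. Two blocks that are exchanged can be
identified with Mat_n × Mat_n with (X, Y) ↦ (Yᵗ, Xᵗ), the complexification of Mat_n(ℂ) with its
conjugate transpose. On a block that is preserved, ⋆ is x ↦ P xᵗ P⁻¹ with P symmetric or
skew-symmetric (`exists_involution_eq`). An orthonormal or symplectic basis for P turns it into
transposition, the complexification of the involution of Mat_n(ℝ), or into the symplectic
involution, that of Mat_n(ℍ). In all three cases an invariant trace form is unique up to scale, and
the scale is μ.

Pseudoreality uses the split real forms: in suitable coordinates φ copies coordinates of ℂᵖ into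
scalar matrices, which makes sense over ℝ. -/

noncomputable section

namespace CardyFrobenius

/-! ### Dual families, Casimir elements and traces -/

section DualFamily

variable {K V W ι κ : Type*} [Field K] [Ring V] [Algebra K V] [AddCommGroup W] [Module K W]
  [Fintype ι] [Fintype κ]

/-- The families `x` and `y` are dual for the form `l(xy)`: the coefficients of `v` with respect to
`x` are the numbers `l(yᵢ v)`. -/
def IsDualFamily (l : V →ₗ[K] K) (x y : ι → V) : Prop := ∀ v, ∑ i, l (y i * v) • x i = v

/-- Both sides have the same pairing with every v, as one sees by expanding v in the family x;
non-degeneracy does the rest. -/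
lemma IsDualFamily.flip {l : V →ₗ[K] K} (hl : ∀ x, (∀ y, l (x * y) = 0) → x = 0) {x y : ι → V}
    (h : IsDualFamily l x y) (u : V) : ∑ i, l (u * x i) • y i = u := by
  rw [← sub_eq_zero]
  refine hl _ fun v => ?_
  have h1 : l (u * v) = ∑ i, l (u * x i) * l (y i * v) := by
    conv_lhs => rw [← h v]
    simp [Finset.mul_sum, mul_comm]
  simp [sub_mul, Finset.sum_mul, h1]

/-- The sum of a bilinear map over dual families does not depend on these. -/
lemma IsDualFamily.sum_eq {l : V →ₗ[K] K} (hl : ∀ x, (∀ y, l (x * y) = 0) → x = 0)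
    {x y : ι → V} {x' y' : κ → V} (h : IsDualFamily l x y) (h' : IsDualFamily l x' y')
    (f : V →ₗ[K] V →ₗ[K] W) : ∑ i, f (x i) (y i) = ∑ k, f (x' k) (y' k) := by
  -- Expand xᵢ in the family x'; after exchanging the sums, the coefficients reassemble y'ₖ from the
  -- yᵢ.
  have h1 : ∀ i, f (x i) (y i) = ∑ k, l (y' k * x i) • f (x' k) (y i) := fun i => by
    conv_lhs => rw [← h' (x i)]
    simp
  simp_rw [h1]
  rw [Finset.sum_comm]
  refine Finset.sum_congr rfl fun k _ => ?_
  conv_rhs => rw [← h.flip hl (y' k)]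
  simp

/-- The Gram matrix G is invertible: if cG = 0, then Σ cᵢ βᵢ is orthogonal to everything. Hence G⁻¹β
is the basis dual to β. -/
lemma exists_isDualFamily_casimir [Module.Finite K V] {l : V →ₗ[K] K}
    (hl : ∀ x, (∀ y, l (x * y) = 0) → x = 0) (s : V →ₗ[K] V) :
    ∃ x y : Fin (Module.finrank K V) → V, IsDualFamily l x y ∧
      casimir l s = ∑ i, x i * s (y i) := by
  set β := Module.finBasis K V
  set G : Matrix _ _ K := Matrix.of fun i j => l (β i * β j) with hG
  have hdet : IsUnit G.det := by
    rw [isUnit_iff_ne_zero]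
    intro h0
    obtain ⟨c, hc, hcG⟩ := Matrix.exists_vecMul_eq_zero_iff.mpr h0
    refine hc ?_
    have hz : ∑ i, c i • β i = 0 := by
      refine hl _ fun v => ?_
      have : (l ∘ₗ LinearMap.mulLeft K (∑ i, c i • β i)) = 0 := by
        refine β.ext fun j => ?_
        have := congrFun hcG j
        simpa [Matrix.vecMul, dotProduct, hG, Finset.sum_mul] using this
      exact LinearMap.congr_fun this v
    funext i
    exact Fintype.linearIndependent_iff.mp β.linearIndependent c hz i
  refine ⟨β, fun i => ∑ j, G⁻¹ i j • β j, fun v => ?_, ?_⟩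
  · have : ∑ i, (l ∘ₗ LinearMap.mulLeft K (∑ j, G⁻¹ i j • β j)).smulRight (β i) = LinearMap.id := by
      refine β.ext fun m => ?_
      have hm : ∀ i, ∑ j, G⁻¹ i j * l (β j * β m) = (1 : Matrix _ _ K) i m := fun i => by
        rw [← Matrix.nonsing_inv_mul G hdet]; rfl
      simp [Finset.sum_mul, hm, Matrix.one_apply]
    simpa using LinearMap.congr_fun this v
  · simp only [casimir, map_sum, map_smul, Finset.mul_sum, mul_smul_comm]
    rfl

lemma casimir_eq_sum [Module.Finite K V] {l : V →ₗ[K] K}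
    (hl : ∀ x, (∀ y, l (x * y) = 0) → x = 0) {x y : ι → V} (h : IsDualFamily l x y)
    (s : V →ₗ[K] V) : casimir l s = ∑ i, x i * s (y i) := by
  obtain ⟨x', y', h', he⟩ := exists_isDualFamily_casimir hl s
  rw [he]
  exact h'.sum_eq hl h ((LinearMap.mul K V).compl₂ s)

/-- T is the sum of the rank-one operators v ↦ l(yᵢ v) T(xᵢ), and each of these has trace l(yᵢ
T(xᵢ)). -/
lemma IsDualFamily.trace_eq [Module.Finite K V] {l : V →ₗ[K] K} {x y : ι → V}
    (h : IsDualFamily l x y) (T : V →ₗ[K] V) : LinearMap.trace K V T = ∑ i, l (y i * T (x i)) := by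
  have hT : T = ∑ i, (l ∘ₗ LinearMap.mulLeft K (y i)).smulRight (T (x i)) := by
    ext v
    conv_lhs => rw [← h v]
    simp
  conv_lhs => rw [hT]
  simp only [map_sum, LinearMap.trace_smulRight]
  rfl

lemma IsDualFamily.map {V' : Type*} [Ring V'] [Algebra K V'] {l : V →ₗ[K] K} {l' : V' →ₗ[K] K}
    {x y : ι → V} (h : IsDualFamily l x y) (e : V ≃ₐ[K] V') (he : ∀ v, l' (e v) = l v) :
    IsDualFamily l' (fun i => e (x i)) (fun i => e (y i)) := by
  intro v
  obtain ⟨v, rfl⟩ := e.surjective v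
  simp only [← map_mul, he, ← map_smul, ← map_sum, h v]

end DualFamily

/-! ### Reconstruction from B and Ker φ -/

/-- `φ` identifies `A` with the centre of `B`, and `l_A`, `U` are the ones that the Cardy condition
and `φ(U) = K_B^⋆` prescribe. -/
structure EquippedData.IsCentral {K : Type w} [Field K] (M : EquippedData.{u, v, w} K) : Prop where
  injective : Function.Injective M.φ
  central : ∀ a b, M.φ a * b = b * M.φ a
  φ_star : ∀ a, M.φ (M.starA a) = M.starB (M.φ a)
  exists_dual : ∃ (ι : Type) (_ : Fintype ι) (x y : ι → M.B), IsDualFamily M.lB x y ∧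
    (∀ b, ∃ a, M.φ a = ∑ i, y i * b * x i ∧ M.lA a = M.lB b) ∧ M.φ M.U = ∑ i, x i * M.starB (y i)

/-- Every central element of `V` is an average `∑ yᵢ b xᵢ` over dual families. -/
def CenterEqAverages (K : Type*) {V : Type*} [Field K] [Ring V] [Algebra K V] (l : V →ₗ[K] K) :
    Prop :=
  ∀ {ι : Type} [Fintype ι] {x y : ι → V}, IsDualFamily l x y →
    ∀ z : V, (∀ b, z * b = b * z) → ∃ b, ∑ i, y i * b * x i = z

namespace EquippedCFAlgebra

attribute [instance] EquippedCFAlgebra.finiteA EquippedCFAlgebra.finiteB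

variable {K : Type w} [Field K] {H : EquippedCFAlgebra.{u, v, w} K}

/-- The element a is φ^*(b). Its pairing with b' after φ is (φ^*(b), φ^*(b'))_A, which the Cardy
condition turns into a trace over B. The adjunction, applied to c and to 1, gives the orthogonality
to Ker φ and the value of l_A. -/
lemma exists_φ_eq_average {ι : Type} [Fintype ι] {x y : ι → H.B} (h : IsDualFamily H.lB x y)
    (b : H.B) : ∃ a, H.φ a = ∑ i, y i * b * x i ∧
      ∀ c, H.φ c = 0 → H.lA (a * c) = 0 ∧ H.lA a = H.lB b := by
  obtain ⟨d, hd, hc⟩ := H.cardy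
  refine ⟨d b, ?_, fun c h0 => ⟨by rw [hd, h0, mul_zero, map_zero], by
    simpa using hd b 1⟩⟩
  rw [← sub_eq_zero]
  refine H.nondegB _ fun b' => ?_
  have h1 : H.lB (H.φ (d b) * b') = H.lA (d b * d b') := by
    rw [H.central, ← hd, mul_comm]
  rw [sub_mul, map_sub, h1, hc, h.trace_eq, sub_eq_zero, Finset.sum_mul, map_sum]
  refine Finset.sum_congr rfl fun i _ => ?_
  simp [sandwich, mul_assoc]

/-- The projection of `A` onto the direct factor `Ker φ`. -/
def toKer (hH : H.IsSemisimple) : H.A →ₐ[K] (H.kernelSummand hH).A where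
  toFun a := H.kerMk (H.kerIncl (kerUnit hH) * a) (by rw [map_mul, φ_kerIncl, zero_mul])
  map_one' := H.kerIncl_injective (mul_one _)
  map_mul' a b := H.kerIncl_injective (by
    change _ * (a * b) = (_ * a) * (_ * b)
    rw [mul_mul_mul_comm, kerUnit_mul])
  map_zero' := H.kerIncl_injective (mul_zero _)
  map_add' a b := H.kerIncl_injective (mul_add _ _ _)
  commutes' r := H.kerIncl_injective (by
    rw [Algebra.algebraMap_eq_smul_one, Algebra.algebraMap_eq_smul_one]
    change _ * (r • 1) = r • H.kerIncl (kerUnit hH)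
    rw [mul_smul_comm, mul_one])

lemma toKer_kerIncl (hH : H.IsSemisimple) (x : H.Ker) : toKer hH (H.kerIncl x) = x :=
  H.kerIncl_injective (kerUnit_mul hH x)

/-- The ideal Ker φ is stable under ⋆, so ⋆ sends its unit to a unit, and units are unique. -/
lemma starA_kerUnit (hH : H.IsSemisimple) :
    H.starA (H.kerIncl (kerUnit hH)) = H.kerIncl (kerUnit hH) := by
  have h1 : ∀ x : H.Ker, H.starA (H.kerIncl (kerUnit hH)) * H.kerIncl x = H.kerIncl x := fun x => by
    have h2 := kerUnit_mul hH (kerStar H x)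
    have h3 : H.kerIncl (kerStar H x) = H.starA (H.kerIncl x) := rfl
    rw [h3] at h2
    have h4 := congrArg H.starA h2
    rwa [H.starA_mul, H.starA_starA, mul_comm] at h4
  have h5 := kerUnit_mul hH (kerStar H (kerUnit hH))
  have h6 : H.kerIncl (kerStar H (kerUnit hH)) = H.starA (H.kerIncl (kerUnit hH)) := rfl
  rw [h6, mul_comm, h1] at h5
  exact h5.symm

/-- An algebra isomorphic to `B` is isomorphic to its product with the zero algebra. -/
def equivProdKer (hH : H.IsSemisimple) {C : Type*} [Ring C] [Algebra K C] (e : H.B ≃ₐ[K] C) :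
    H.B ≃ₐ[K] C × (H.kernelSummand hH).B where
  toFun b := (e b, 0)
  invFun p := e.symm p.1
  left_inv b := e.symm_apply_apply b
  right_inv p := Prod.ext (e.apply_symm_apply p.1) rfl
  map_mul' a b := Prod.ext (map_mul e a b) rfl
  map_add' a b := Prod.ext (map_add e a b) rfl
  commutes' r := Prod.ext (e.commutes r) rfl

/-- A semi-simple equipped Cardy–Frobenius algebra is determined by `(B, l_B, ⋆)` and `Ker φ`. -/
theorem exists_iso_prod_kernelSummand (hH : H.IsSemisimple) (hZ : CenterEqAverages K H.lB)
    {M : EquippedData.{u₁, v₁, w} K} (hM : M.IsCentral) (e : H.B ≃ₐ[K] M.B)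
    (hl : ∀ b, M.lB (e b) = H.lB b) (hs : ∀ b, e (H.starB b) = M.starB (e b)) :
    ∃ f : H.toEquippedData.Iso (M.prod (H.kernelSummand hH)),
      ∀ x : H.Ker, f.equivA (H.kerIncl x) = (0, x) := by
  obtain ⟨ι, _, x, y, hxy, hav, hU⟩ := hM.exists_dual
  have hl' : ∀ b, H.lB (e.symm b) = M.lB b := fun b => by rw [← hl, e.apply_symm_apply]
  have hxy' : IsDualFamily H.lB (fun i => e.symm (x i)) (fun i => e.symm (y i)) :=
    hxy.map e.symm hl'
  have hav' : ∀ b, e (∑ i, e.symm (y i) * b * e.symm (x i)) = ∑ i, y i * e b * x i := fun b => by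
    simp
  -- The element m has the central value of a, and its form value is that of the part of a
  -- complementary to Ker φ. Both come from one b whose average is φ(a).
  have key : ∀ a : H.A, ∃ m : M.A, M.φ m = e (H.φ a) ∧
      M.lA m = H.lA (a - H.kerIncl (kerUnit hH) * a) := by
    intro a
    obtain ⟨b, hb⟩ := hZ hxy' (H.φ a) (H.central a)
    obtain ⟨m, hm, hml⟩ := hav (e b)
    obtain ⟨a', ha', hal⟩ := H.exists_φ_eq_average hxy' b
    refine ⟨m, by rw [hm, ← hav', hb], ?_⟩
    have h0 : H.φ (a - a') = 0 := by rw [map_sub, ha', hb, sub_self]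
    have h1 := kerUnit_mul hH (H.kerMk (a - a') h0)
    rw [kerIncl_kerMk, mul_sub] at h1
    -- The complementary idempotent 1 - e kills a - a' ∈ Ker φ.
    have h2 : a - H.kerIncl (kerUnit hH) * a = a' - a' * H.kerIncl (kerUnit hH) := by
      rw [mul_comm a', sub_eq_sub_iff_sub_eq_sub, h1]
    obtain ⟨h3, h4⟩ := hal _ (H.φ_kerIncl (kerUnit hH))
    rw [h2, map_sub, h3, h4, sub_zero, hml, hl]
  let E := AlgEquiv.ofInjective M.φ hM.injective
  have hmem : ∀ a, (e.toAlgHom.comp H.φ) a ∈ M.φ.range := fun a => by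
    obtain ⟨m, hm, -⟩ := key a
    exact ⟨m, hm⟩
  let g : H.A →ₐ[K] M.A := E.symm.toAlgHom.comp ((e.toAlgHom.comp H.φ).codRestrict _ hmem)
  have hg : ∀ a, M.φ (g a) = e (H.φ a) := fun a => by
    have : E (g a) = (e.toAlgHom.comp H.φ).codRestrict _ hmem a := E.apply_symm_apply _
    exact congrArg Subtype.val this
  let q : H.A →ₐ[K] M.A × (H.kernelSummand hH).A := g.prod (toKer hH)
  have hq : Function.Bijective q := by
    constructor
    · rw [injective_iff_map_eq_zero]
      intro a ha
      have h1 : g a = 0 := congrArg Prod.fst ha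
      have h2 : toKer hH a = 0 := congrArg Prod.snd ha
      have h3 : H.φ a = 0 := by
        have := hg a
        rw [h1, map_zero] at this
        exact (map_eq_zero_iff e e.injective).mp this.symm
      have h4 := toKer_kerIncl hH (H.kerMk a h3)
      rw [kerIncl_kerMk, h2] at h4
      exact (congrArg H.kerIncl h4).symm
    · rintro ⟨m, k⟩
      -- The image of m is central, hence an average, hence in the image of φ. An element of Ker φ
      -- then corrects the second component.
      obtain ⟨b, hb⟩ := hZ hxy' (e.symm (M.φ m)) fun b => e.injective (by simp [hM.central])
      obtain ⟨a, ha, -⟩ := H.exists_φ_eq_average hxy' b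
      have hga : g a = m := hM.injective (by rw [hg, ha, hb, e.apply_symm_apply])
      obtain ⟨k', hk'⟩ : ∃ k' : H.Ker, toKer hH (H.kerIncl k') = k - toKer hH a :=
        ⟨_, toKer_kerIncl hH (k - toKer hH a)⟩
      refine ⟨a + H.kerIncl k', ?_⟩
      have h0 : g (H.kerIncl k') = 0 :=
        hM.injective (by rw [hg, φ_kerIncl, map_zero, map_zero])
      refine Prod.ext ?_ ?_
      · change g _ = m
        rw [map_add, h0, hga, add_zero]
      · change toKer hH _ = k
        rw [map_add, hk', add_sub_cancel]
  have hgl : ∀ a, M.lA (g a) = H.lA (a - H.kerIncl (kerUnit hH) * a) := fun a => by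
    obtain ⟨m, hm, hml⟩ := key a
    rw [← hml, hM.injective ((hg a).trans hm.symm)]
  refine ⟨{ equivA := AlgEquiv.ofBijective q hq
            equivB := equivProdKer hH e
            map_lA := fun a => ?_
            map_lB := fun b => ?_
            map_φ := fun a => ?_
            map_U := ?_
            map_starA := fun a => ?_
            map_starB := fun b => ?_ }, fun k => ?_⟩
  · change M.lA (g a) + H.lA (H.kerIncl (kerUnit hH) * a) = H.lA a
    rw [hgl, map_sub, sub_add_cancel]
  · change M.lB (e b) + 0 = H.lB b
    rw [hl, add_zero]
  · exact Prod.ext (hg a).symm rfl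
  · refine Prod.ext (hM.injective ?_) rfl
    -- Both elements U are mapped to Casimir elements, and these do not depend on the dual families.
    refine (hg H.U).trans ?_
    change e (H.φ H.U) = M.φ M.U
    rw [hU, H.φ_U, casimir_eq_sum H.nondegB hxy']
    simp [hs]
  · refine Prod.ext (hM.injective ?_) (H.kerIncl_injective ?_)
    · change M.φ (g _) = M.φ (M.starA (g a))
      rw [hg, hM.φ_star, hg, H.φ_star, hs]
    · change H.kerIncl (kerUnit hH) * H.starA a = H.starA (H.kerIncl (kerUnit hH) * a)
      rw [H.starA_mul, starA_kerUnit, mul_comm]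
  · exact Prod.ext (hs b) rfl
  · refine Prod.ext (hM.injective ?_) (toKer_kerIncl hH k)
    change M.φ (g _) = M.φ 0
    rw [hg, φ_kerIncl, map_zero, map_zero]

end EquippedCFAlgebra

/-! ### The models over a real algebra with a unit frame -/

section Models

variable {D : Type} [Ring D] [Algebra ℝ D]

/-- The form `l_B` of `modelOver`. -/
def matrixForm (re : D →ₗ[ℝ] ℝ) (n : ℕ) (μ : ℂ) : ℂ ⊗[ℝ] Matrix (Fin n) (Fin n) D →ₗ[ℂ] ℂ :=
  LinearMap.liftBaseChange ℂ ((re ∘ₗ Matrix.traceLinearMap (Fin n) ℝ D).smulRight μ)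

lemma matrixForm_tmul (re : D →ₗ[ℝ] ℝ) (n : ℕ) (μ z : ℂ) (X : Matrix (Fin n) (Fin n) D) :
    matrixForm re n μ (z ⊗ₜ[ℝ] X) = z * (re X.trace * μ) := by
  simp [matrixForm]

/-- The form `l_A` of `modelOver`. -/
def centerForm (re : D →ₗ[ℝ] ℝ) (μ : ℂ) : ℂ ⊗[ℝ] Subalgebra.center ℝ D →ₗ[ℂ] ℂ :=
  LinearMap.liftBaseChange ℂ
    ((re ∘ₗ (Subalgebra.center ℝ D).val.toLinearMap).smulRight (μ ^ 2 / (Module.finrank ℝ D : ℂ)))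

lemma centerForm_tmul (re : D →ₗ[ℝ] ℝ) (μ z : ℂ) (a : Subalgebra.center ℝ D) :
    centerForm re μ (z ⊗ₜ[ℝ] a) = z * (re a * (μ ^ 2 / (Module.finrank ℝ D : ℂ))) := by
  simp [centerForm]

variable (D) in
/-- The homomorphism `φ` of `modelOver`. -/
def scalarMap (n : ℕ) :
    ℂ ⊗[ℝ] Subalgebra.center ℝ D →ₐ[ℂ] ℂ ⊗[ℝ] Matrix (Fin n) (Fin n) D :=
  Algebra.TensorProduct.map (AlgHom.id ℂ ℂ)
    ((Matrix.scalarAlgHom (Fin n) ℝ).comp (Subalgebra.center ℝ D).val)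

lemma scalarMap_tmul (n : ℕ) (z : ℂ) (a : Subalgebra.center ℝ D) :
    scalarMap D n (z ⊗ₜ[ℝ] a) = z ⊗ₜ[ℝ] Matrix.scalar (Fin n) (a : D) := rfl

lemma scalarMap_injective {n : ℕ} (hn : 0 < n) : Function.Injective (scalarMap D n) := by
  have : Nonempty (Fin n) := ⟨⟨0, hn⟩⟩
  exact Module.Flat.lTensor_preserves_injective_linearMap (M := ℂ)
    (((Matrix.scalarAlgHom (Fin n) ℝ).comp (Subalgebra.center ℝ D).val).toLinearMap)
    (fun a b hab => Subtype.ext (Matrix.scalar_inj.mp hab))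

lemma scalarMap_mul_comm (n : ℕ) (a : ℂ ⊗[ℝ] Subalgebra.center ℝ D)
    (b : ℂ ⊗[ℝ] Matrix (Fin n) (Fin n) D) : scalarMap D n a * b = b * scalarMap D n a := by
  induction a with
  | zero => simp
  | add a a' h h' => simp only [map_add, add_mul, mul_add, h, h']
  | tmul w a =>
    induction b with
    | zero => simp
    | add b b' h h' => simp only [add_mul, mul_add, h, h']
    | tmul z X =>
      rw [scalarMap_tmul, Algebra.TensorProduct.tmul_mul_tmul, Algebra.TensorProduct.tmul_mul_tmul,
        mul_comm w, (Matrix.scalar_commute (a : D)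
          (fun r => (Subalgebra.mem_center_iff.mp a.2 r).symm) X).eq]

variable [StarRing D]

/-- An orthonormal family of unit elements of `D`, such as `1, i, j, k`. -/
structure IsUnitFrame {κ : Type} [Fintype κ] (re : D →ₗ[ℝ] ℝ) (q : κ → D) : Prop where
  expand : ∀ v, ∑ k, re (star (q k) * v) • q k = v
  re_mul_comm : ∀ x y, re (x * y) = re (y * x)
  re_star : ∀ x, re (star x) = re x
  re_one : re 1 = 1
  mul_star : ∀ k, q k * star (q k) = 1
  sum_sq : ∑ k, q k * q k = algebraMap ℝ D (2 - Module.finrank ℝ D)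
  average_mem_center : ∀ t, ∑ k, star (q k) * t * q k ∈ Subalgebra.center ℝ D
  card_eq : Fintype.card κ = Module.finrank ℝ D
  finrank_ne_zero : Module.finrank ℝ D ≠ 0

/-- Pairing X with E_ji q̄ₖ extracts the qₖ-coordinate of the entry X_ij; the factor μ⁻¹ cancels the
scale of the form. -/
lemma matrixForm_isDualFamily {κ : Type} [Fintype κ] {re : D →ₗ[ℝ] ℝ} {q : κ → D}
    (hq : IsUnitFrame re q) (n : ℕ) {μ : ℂ} (hμ : μ ≠ 0) :
    IsDualFamily (matrixForm re n μ)
      (fun p : (Fin n × Fin n) × κ => (1 : ℂ) ⊗ₜ[ℝ] Matrix.single p.1.1 p.1.2 (q p.2))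
      (fun p => μ⁻¹ ⊗ₜ[ℝ] Matrix.single p.1.2 p.1.1 (star (q p.2))) := by
  intro v
  induction v with
  | zero => simp
  | add a b ha hb => simp only [mul_add, map_add, add_smul, Finset.sum_add_distrib, ha, hb]
  | tmul z X =>
    have h1 : ∀ p : (Fin n × Fin n) × κ, (matrixForm re n μ)
        ((μ⁻¹ ⊗ₜ[ℝ] Matrix.single p.1.2 p.1.1 (star (q p.2))) * (z ⊗ₜ[ℝ] X)) •
          ((1 : ℂ) ⊗ₜ[ℝ] Matrix.single p.1.1 p.1.2 (q p.2)) =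
        z ⊗ₜ[ℝ] Matrix.single p.1.1 p.1.2 (re (star (q p.2) * X p.1.1 p.1.2) • q p.2) := fun p => by
      rw [Algebra.TensorProduct.tmul_mul_tmul, matrixForm_tmul, Matrix.trace_single_mul,
        ← Matrix.smul_single, TensorProduct.tmul_smul,
        TensorProduct.smul_tmul', TensorProduct.smul_tmul', smul_eq_mul, smul_eq_mul, mul_one,
        Complex.real_smul]
      congr 1
      field_simp
    refine (Finset.sum_congr rfl fun p _ => h1 p).trans ?_
    rw [← TensorProduct.tmul_sum, Fintype.sum_prod_type, Fintype.sum_prod_type]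
    congr 1
    conv_rhs => rw [Matrix.matrix_eq_sum_single X]
    refine Finset.sum_congr rfl fun i _ => Finset.sum_congr rfl fun j _ => ?_
    conv_rhs => rw [← hq.expand (X i j)]
    exact (map_sum (Matrix.singleAddMonoidHom (α := D) i j) _ _).symm

/-- As E_ji q̄ X E_ij q = (q̄ X_ii q) E_jj, the average is the scalar matrix μ⁻¹ Σ q̄ tr(X) q. Since
Re Σ q̄ t q = d Re t, the normalisation μ²/d of l_A is exactly what makes l_A agree with l_B here.
-/
lemma exists_scalarMap_eq_average {κ : Type} [Fintype κ] {re : D →ₗ[ℝ] ℝ} {q : κ → D}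
    (hq : IsUnitFrame re q) (n : ℕ) {μ : ℂ} (hμ : μ ≠ 0) (b : ℂ ⊗[ℝ] Matrix (Fin n) (Fin n) D) :
    ∃ a, scalarMap D n a = ∑ p : (Fin n × Fin n) × κ,
      (μ⁻¹ ⊗ₜ[ℝ] Matrix.single p.1.2 p.1.1 (star (q p.2))) * b *
        ((1 : ℂ) ⊗ₜ[ℝ] Matrix.single p.1.1 p.1.2 (q p.2)) ∧
      centerForm re μ a = matrixForm re n μ b := by
  induction b with
  | zero => exact ⟨0, by simp⟩
  | add b b' h h' =>
    obtain ⟨a, ha, hal⟩ := h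
    obtain ⟨a', ha', hal'⟩ := h'
    exact ⟨a + a', by simp only [map_add, ha, ha', mul_add, add_mul, Finset.sum_add_distrib],
      by rw [map_add, map_add, hal, hal']⟩
  | tmul z X =>
    refine ⟨(z * μ⁻¹) ⊗ₜ[ℝ] ⟨_, hq.average_mem_center X.trace⟩, ?_, ?_⟩
    · have h1 : ∀ p : (Fin n × Fin n) × κ,
        (μ⁻¹ ⊗ₜ[ℝ] Matrix.single p.1.2 p.1.1 (star (q p.2)) :
          ℂ ⊗[ℝ] Matrix (Fin n) (Fin n) D) * (z ⊗ₜ[ℝ] X) *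
          ((1 : ℂ) ⊗ₜ[ℝ] Matrix.single p.1.1 p.1.2 (q p.2)) =
        (z * μ⁻¹) ⊗ₜ[ℝ] Matrix.single p.1.2 p.1.2 (star (q p.2) * X p.1.1 p.1.1 * q p.2) :=
        fun p => by
          rw [Algebra.TensorProduct.tmul_mul_tmul, Algebra.TensorProduct.tmul_mul_tmul, mul_one,
            Matrix.single_mul_mul_single, mul_comm z]
      refine Eq.trans ?_ (Finset.sum_congr rfl fun p _ => h1 p).symm
      rw [← TensorProduct.tmul_sum]
      rw [scalarMap_tmul]
      congr 1
      rw [Fintype.sum_prod_type, Fintype.sum_prod_type_right, Matrix.scalar_apply]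
      ext i j
      simp only [Matrix.diagonal_apply, Matrix.sum_apply, Matrix.single_apply, Matrix.trace,
        Finset.mul_sum, Finset.sum_mul, Matrix.diag_apply]
      split_ifs with hij
      · subst hij
        simp [Finset.sum_comm (s := (Finset.univ : Finset κ))]
      · refine (Finset.sum_eq_zero fun l _ => Finset.sum_eq_zero fun m _ =>
          Finset.sum_eq_zero fun k _ => if_neg ?_).symm
        rintro ⟨rfl, rfl⟩
        exact hij rfl
    · rw [centerForm_tmul, matrixForm_tmul]
      have h2 : re (∑ k, star (q k) * X.trace * q k) = Module.finrank ℝ D * re X.trace := by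
        rw [map_sum, ← hq.card_eq]
        rw [Finset.sum_congr rfl fun k _ => show re (star (q k) * X.trace * q k) = re X.trace by
          rw [mul_assoc, hq.re_mul_comm, mul_assoc, hq.mul_star, mul_one]]
        simp
      have h3 : (Module.finrank ℝ D : ℂ) ≠ 0 := Nat.cast_ne_zero.mpr hq.finrank_ne_zero
      rw [h2]
      simp only [Complex.ofReal_mul, Complex.ofReal_natCast]
      field_simp

lemma matrixForm_mul_comm {κ : Type} [Fintype κ] {re : D →ₗ[ℝ] ℝ} {q : κ → D}
    (hq : IsUnitFrame re q) (n : ℕ) (μ : ℂ) (x y : ℂ ⊗[ℝ] Matrix (Fin n) (Fin n) D) :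
    matrixForm re n μ (x * y) = matrixForm re n μ (y * x) := by
  induction x with
  | zero => simp
  | add a b ha hb => simp only [mul_add, add_mul, map_add, ha, hb]
  | tmul z X =>
    induction y with
    | zero => simp
    | add a b ha hb => simp only [mul_add, add_mul, map_add, ha, hb]
    | tmul w Y =>
      rw [Algebra.TensorProduct.tmul_mul_tmul, Algebra.TensorProduct.tmul_mul_tmul, matrixForm_tmul,
        matrixForm_tmul, mul_comm z]
      congr 3
      simp only [Matrix.trace, Matrix.diag_apply, Matrix.mul_apply, map_sum]
      rw [Finset.sum_comm]
      simp only [hq.re_mul_comm (X _ _)]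

lemma matrixForm_one {κ : Type} [Fintype κ] {re : D →ₗ[ℝ] ℝ} {q : κ → D}
    (hq : IsUnitFrame re q) (n : ℕ) (μ : ℂ) :
    matrixForm re n μ (1 : ℂ ⊗[ℝ] Matrix (Fin n) (Fin n) D) = n * μ := by
  rw [Algebra.TensorProduct.one_def, matrixForm_tmul, Matrix.trace_one, ← nsmul_one, map_nsmul,
    hq.re_one]
  simp

variable [StarModule ℝ D]

lemma scalarMap_centerConj (n : ℕ) (a : ℂ ⊗[ℝ] Subalgebra.center ℝ D) :
    scalarMap D n ((centerConj D).baseChange ℂ a) =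
      (matrixConj D n).baseChange ℂ (scalarMap D n a) := by
  induction a with
  | zero => simp
  | add a a' h h' => simp only [map_add, h, h']
  | tmul w a =>
    change w ⊗ₜ[ℝ] Matrix.scalar (Fin n) (star (a : D)) =
      w ⊗ₜ[ℝ] (Matrix.scalar (Fin n) (a : D)).conjTranspose
    rw [Matrix.scalar_apply, Matrix.scalar_apply, Matrix.diagonal_conjTranspose]
    rfl

/-- Conjugation turns E_ji q̄ into E_ij q, so only the terms E_ii q² with i = j survive; Σ q² = 2 -
d explains the choice of U. -/
lemma scalarMap_eq_casimir {κ : Type} [Fintype κ] {re : D →ₗ[ℝ] ℝ} {q : κ → D}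
    (hq : IsUnitFrame re q) (n : ℕ) (μ : ℂ) :
    scalarMap D n (((2 - (Module.finrank ℝ D : ℂ)) / μ) ⊗ₜ[ℝ] 1) =
      ∑ p : (Fin n × Fin n) × κ, ((1 : ℂ) ⊗ₜ[ℝ] Matrix.single p.1.1 p.1.2 (q p.2)) *
        (matrixConj D n).baseChange ℂ (μ⁻¹ ⊗ₜ[ℝ] Matrix.single p.1.2 p.1.1 (star (q p.2))) := by
  have h1 : ∀ p : (Fin n × Fin n) × κ,
      ((1 : ℂ) ⊗ₜ[ℝ] Matrix.single p.1.1 p.1.2 (q p.2) : ℂ ⊗[ℝ] Matrix (Fin n) (Fin n) D) *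
        (matrixConj D n).baseChange ℂ (μ⁻¹ ⊗ₜ[ℝ] Matrix.single p.1.2 p.1.1 (star (q p.2))) =
      μ⁻¹ ⊗ₜ[ℝ] (if p.1.1 = p.1.2 then Matrix.single p.1.1 p.1.1 (q p.2 * q p.2) else 0) :=
    fun p => by
      change _ * (μ⁻¹ ⊗ₜ[ℝ] (Matrix.single p.1.2 p.1.1 (star (q p.2))).conjTranspose) = _
      rw [Algebra.TensorProduct.tmul_mul_tmul, Matrix.conjTranspose_single, star_star, one_mul]
      split_ifs with h
      · rw [← h, Matrix.single_mul_single_same]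
      · rw [Matrix.single_mul_single_of_ne _ _ _ _ (Ne.symm h)]
  refine Eq.trans ?_ (Finset.sum_congr rfl fun p _ => h1 p).symm
  rw [← TensorProduct.tmul_sum, Fintype.sum_prod_type, Fintype.sum_prod_type]
  have h2 : ∑ i : Fin n, ∑ j : Fin n, ∑ k, (if i = j then Matrix.single i i (q k * q k) else 0) =
      algebraMap ℝ (Matrix (Fin n) (Fin n) D) (2 - Module.finrank ℝ D) := by
    have h3 : ∀ i : Fin n, ∑ j : Fin n, ∑ k, (if i = j then Matrix.single i i (q k * q k) else 0) =
        Matrix.single i i (algebraMap ℝ D (2 - Module.finrank ℝ D)) := fun i => by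
      rw [Finset.sum_comm, ← hq.sum_sq]
      simp only [Finset.sum_ite_eq, Finset.mem_univ, if_true]
      exact (map_sum (Matrix.singleAddMonoidHom (α := D) i i) _ _).symm
    simp only [h3]
    ext a b
    rw [Matrix.sum_apply, Matrix.algebraMap_matrix_apply]
    split_ifs with hab
    · subst hab
      simp [Matrix.single_apply]
    · refine Finset.sum_eq_zero fun i _ => ?_
      rw [Matrix.single_apply, if_neg]
      rintro ⟨rfl, rfl⟩
      exact hab rfl
  rw [scalarMap_tmul]
  simp only [h2]
  rw [Algebra.algebraMap_eq_smul_one, TensorProduct.tmul_smul, TensorProduct.smul_tmul']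
  congr 1
  · simp only [Complex.real_smul]
    push_cast
    ring

lemma modelOver_isCentral {κ : Type} [Fintype κ] {re : D →ₗ[ℝ] ℝ} {q : κ → D}
    (hq : IsUnitFrame re q) {n : ℕ} (hn : 0 < n) {μ : ℂ} (hμ : μ ≠ 0) :
    (modelOver D re n μ).IsCentral where
  injective := scalarMap_injective hn
  central := scalarMap_mul_comm n
  φ_star := scalarMap_centerConj n
  exists_dual := ⟨(Fin n × Fin n) × κ, inferInstance, _, _, matrixForm_isDualFamily hq n hμ,
    exists_scalarMap_eq_average hq n hμ, scalarMap_eq_casimir hq n μ⟩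


lemma matrixForm_matrixConj {κ : Type} [Fintype κ] {re : D →ₗ[ℝ] ℝ} {q : κ → D}
    (hq : IsUnitFrame re q) (n : ℕ) (μ : ℂ) (x : ℂ ⊗[ℝ] Matrix (Fin n) (Fin n) D) :
    matrixForm re n μ ((matrixConj D n).baseChange ℂ x) = matrixForm re n μ x := by
  induction x with
  | zero => simp
  | add a b ha hb => simp only [map_add, ha, hb]
  | tmul z X =>
    change matrixForm re n μ (z ⊗ₜ[ℝ] X.conjTranspose) = _
    rw [matrixForm_tmul, matrixForm_tmul, Matrix.trace_conjTranspose, hq.re_star]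

end Models

/-! ### Unit frames of ℝ, ℂ and ℍ -/

lemma isUnitFrame_real : IsUnitFrame (LinearMap.id : ℝ →ₗ[ℝ] ℝ) (fun _ : Unit => (1 : ℝ)) where
  expand v := by simp
  re_mul_comm x y := mul_comm x y
  re_star _ := rfl
  re_one := rfl
  mul_star _ := by simp
  sum_sq := by norm_num
  average_mem_center t := by simp [mul_comm]
  card_eq := by simp
  finrank_ne_zero := by simp

lemma isUnitFrame_complex : IsUnitFrame Complex.reLm ![1, Complex.I] where
  expand v := by apply Complex.ext <;> simp
  re_mul_comm x y := by rw [mul_comm]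
  re_star _ := rfl
  re_one := rfl
  mul_star k := by fin_cases k <;> simp
  sum_sq := by simp
  average_mem_center t := by simp [mul_comm]
  card_eq := by simp
  finrank_ne_zero := by simp

/-- The quaternion units `1, i, j, k`. -/
def quaternionUnits : Fin 4 → ℍ[ℝ] := ![⟨1, 0, 0, 0⟩, ⟨0, 1, 0, 0⟩, ⟨0, 0, 1, 0⟩, ⟨0, 0, 0, 1⟩]

lemma re_quaternionUnits (k : Fin 4) : (quaternionUnits k).re = ![1, 0, 0, 0] k := by
  fin_cases k <;> rfl

lemma imI_quaternionUnits (k : Fin 4) : (quaternionUnits k).imI = ![0, 1, 0, 0] k := by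
  fin_cases k <;> rfl

lemma imJ_quaternionUnits (k : Fin 4) : (quaternionUnits k).imJ = ![0, 0, 1, 0] k := by
  fin_cases k <;> rfl

lemma imK_quaternionUnits (k : Fin 4) : (quaternionUnits k).imK = ![0, 0, 0, 1] k := by
  fin_cases k <;> rfl

/-- Three of the four units square to -1, hence Σ q² = -2 = 2 - 4; averaging over the frame gives Σ
q̄ t q = 4 Re t. -/
lemma isUnitFrame_quaternion :
    IsUnitFrame (D := ℍ[ℝ]) (QuaternionAlgebra.reₗ (-1) 0 (-1)) quaternionUnits where
  expand v := by
    change ∑ k, (star (quaternionUnits k) * v).re • quaternionUnits k = v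
    rw [Fin.sum_univ_four]
    ext <;> simp [re_quaternionUnits, imI_quaternionUnits, imJ_quaternionUnits,
      imK_quaternionUnits]
  re_mul_comm x y := by
    change (x * y).re = (y * x).re
    simp only [Quaternion.re_mul]
    ring
  re_star x := Quaternion.re_star x
  re_one := rfl
  mul_star k := by
    fin_cases k <;> ext <;> simp [re_quaternionUnits, imI_quaternionUnits, imJ_quaternionUnits,
      imK_quaternionUnits]
  sum_sq := by
    rw [Quaternion.finrank_eq_four, Fin.sum_univ_four, show ((2 : ℝ) - (4 : ℕ)) = -2 by norm_num]
    ext <;> simp [re_quaternionUnits, imI_quaternionUnits, imJ_quaternionUnits,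
      imK_quaternionUnits]
    norm_num
  average_mem_center t := by
    have : ∑ k, star (quaternionUnits k) * t * quaternionUnits k =
        algebraMap ℝ ℍ[ℝ] (4 * t.re) := by
      rw [Fin.sum_univ_four]
      ext <;> simp [re_quaternionUnits, imI_quaternionUnits, imJ_quaternionUnits,
        imK_quaternionUnits]
      ring
    rw [this]
    exact Subalgebra.algebraMap_mem _ _
  card_eq := by rw [Quaternion.finrank_eq_four, Fintype.card_fin]
  finrank_ne_zero := by rw [Quaternion.finrank_eq_four]; norm_num

lemma model_isCentral (D : DivisionType) {n : ℕ} (hn : 0 < n) {μ : ℂ} (hμ : μ ≠ 0) :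
    (model D n μ).IsCentral := by
  cases D
  · exact modelOver_isCentral isUnitFrame_real hn hμ
  · exact modelOver_isCentral isUnitFrame_complex hn hμ
  · exact modelOver_isCentral isUnitFrame_quaternion hn hμ

/-! ### Direct sums of central data -/

section DirectSum

variable {K : Type w} [Field K] {k : ℕ}

lemma sum_sigma_single {ι : Fin k → Type*} [∀ i, Fintype (ι i)] {V : Fin k → Type*}
    [∀ i, AddCommMonoid (V i)] (s : ∀ p : Σ i, ι i, V p.1) :
    ∑ p, Pi.single p.1 (s p) = fun i => ∑ m, s ⟨i, m⟩ := by
  rw [Fintype.sum_sigma]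
  ext j
  rw [Finset.sum_apply, Finset.sum_eq_single j]
  · simp [Finset.sum_apply]
  · intro i _ hi
    simp [Finset.sum_apply, Pi.single_eq_of_ne (Ne.symm hi)]
  · simp

lemma single_mul_eq {V : Fin k → Type*} [∀ i, Ring (V i)] (i : Fin k) (a : V i) (b : ∀ i, V i) :
    Pi.single i a * b = Pi.single i (a * b i) := by
  ext j
  by_cases h : j = i
  · subst h; simp
  · simp [Pi.single_eq_of_ne h]

lemma map_pi_single {V W : Fin k → Type*} [∀ i, AddCommMonoid (V i)] [∀ i, AddCommMonoid (W i)]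
    [∀ i, Module K (V i)] [∀ i, Module K (W i)] (f : ∀ i, V i →ₗ[K] W i) (i : Fin k) (a : V i) :
    (LinearMap.pi fun i => f i ∘ₗ LinearMap.proj i) (Pi.single i a) = Pi.single i (f i a) := by
  ext j
  by_cases h : j = i
  · subst h; simp
  · simp [Pi.single_eq_of_ne h]

/-- Multiplying by an element of one factor discards all other coordinates, so each v is recovered
factor by factor. -/
lemma IsDualFamily.pi {ι : Fin k → Type*} [∀ i, Fintype (ι i)] {V : Fin k → Type*}
    [∀ i, Ring (V i)] [∀ i, Algebra K (V i)] {l : ∀ i, V i →ₗ[K] K} {x y : ∀ i, ι i → V i}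
    (h : ∀ i, IsDualFamily (l i) (x i) (y i)) :
    IsDualFamily (∑ i, l i ∘ₗ LinearMap.proj i)
      (fun p : Σ i, ι i => Pi.single p.1 (x p.1 p.2))
      (fun p => Pi.single p.1 (y p.1 p.2)) := by
  intro v
  have h1 : ∀ p : Σ i, ι i, (∑ i, l i ∘ₗ LinearMap.proj i) (Pi.single p.1 (y p.1 p.2) * v) •
      (Pi.single p.1 (x p.1 p.2) : ∀ i, V i) =
      Pi.single p.1 (l p.1 (y p.1 p.2 * v p.1) • x p.1 p.2) := fun p => by
    rw [single_mul_eq, LinearMap.sum_apply, Finset.sum_eq_single p.1]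
    · ext j
      by_cases h : j = p.1
      · subst h; simp
      · simp [Pi.single_eq_of_ne h]
    · intro i _ hi
      simp [Pi.single_eq_of_ne hi]
    · simp
  simp only [h1]
  rw [sum_sigma_single]
  exact funext fun i => h i (v i)

lemma pi_average {ι : Fin k → Type*} [∀ i, Fintype (ι i)] {V : Fin k → Type*}
    [∀ i, Ring (V i)] (x y : ∀ i, ι i → V i) (b : ∀ i, V i) :
    ∑ p : Σ i, ι i, (Pi.single p.1 (y p.1 p.2) : ∀ i, V i) * b * Pi.single p.1 (x p.1 p.2) =
      fun i => ∑ m, y i m * b i * x i m := by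
  simp only [single_mul_eq, Pi.single_eq_same]
  rw [sum_sigma_single]

lemma pi_casimir {ι : Fin k → Type*} [∀ i, Fintype (ι i)] {V : Fin k → Type*}
    [∀ i, Ring (V i)] [∀ i, Algebra K (V i)] (x y : ∀ i, ι i → V i) (s : ∀ i, V i →ₗ[K] V i) :
    ∑ p : Σ i, ι i, (Pi.single p.1 (x p.1 p.2) : ∀ i, V i) *
      (LinearMap.pi fun i => s i ∘ₗ LinearMap.proj i) (Pi.single p.1 (y p.1 p.2)) =
      fun i => ∑ m, x i m * s i (y i m) := by
  simp only [map_pi_single, single_mul_eq, Pi.single_eq_same]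
  rw [sum_sigma_single]

lemma pi_form_apply {V : Fin k → Type*} [∀ i, AddCommMonoid (V i)] [∀ i, Module K (V i)]
    (l : ∀ i, V i →ₗ[K] K) (b : ∀ i, V i) :
    (∑ i, l i ∘ₗ LinearMap.proj i) b = ∑ i, l i (b i) := by
  simp [LinearMap.sum_apply]

lemma EquippedData.IsCentral.directSum {F : Fin k → EquippedData.{u, v, w} K}
    (hF : ∀ i, (F i).IsCentral) : (EquippedData.directSum F).IsCentral where
  injective a a' h := funext fun i => (hF i).injective (congrFun h i)
  central a b := funext fun i => (hF i).central (a i) (b i)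
  φ_star a := funext fun i => (hF i).φ_star (a i)
  exists_dual := by
    choose ι _ x y hxy hav hU using fun i => (hF i).exists_dual
    refine ⟨Σ i, ι i, inferInstance, _, _, IsDualFamily.pi hxy, fun b => ?_,
      (funext hU).trans (pi_casimir x y _).symm⟩
    choose a ha hal using fun i => hav i (b i)
    exact ⟨a, (funext ha).trans (pi_average x y b).symm, (pi_form_apply _ a).trans
      ((Finset.sum_congr rfl fun i _ => hal i).trans (pi_form_apply _ b).symm)⟩

end DirectSum

/-! ### Trace forms, automorphisms and involutions of matrix algebras -/

section MatrixForms

variable {ι : Type*} [Fintype ι] [DecidableEq ι]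

/-- For i ≠ j both E_ij = [E_ii, E_ij] and E_ii - E_jj = [E_ij, E_ji] are commutators, so l vanishes
on them. -/
lemma exists_eq_smul_trace (l : Matrix ι ι ℂ →ₗ[ℂ] ℂ) (hl : ∀ x y, l (x * y) = l (y * x)) :
    ∃ c : ℂ, ∀ x, l x = c * x.trace := by
  have h1 : ∀ i j : ι, i ≠ j → l (Matrix.single i j 1) = 0 := fun i j hij => by
    have := hl (Matrix.single i i 1) (Matrix.single i j 1)
    rwa [Matrix.single_mul_single_same, Matrix.single_mul_single_of_ne _ _ _ _ hij.symm, map_zero,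
      one_mul] at this
  have h2 : ∀ i j : ι, l (Matrix.single i i 1) = l (Matrix.single j j 1) := fun i j => by
    have := hl (Matrix.single i j 1) (Matrix.single j i 1)
    rwa [Matrix.single_mul_single_same, Matrix.single_mul_single_same, one_mul] at this
  rcases isEmpty_or_nonempty ι with h | ⟨⟨i₀⟩⟩
  · exact ⟨0, fun x => by rw [Subsingleton.elim x 0]; simp⟩
  refine ⟨l (Matrix.single i₀ i₀ 1), fun x => ?_⟩
  conv_lhs => rw [Matrix.matrix_eq_sum_single x]
  simp only [map_sum, Matrix.trace, Matrix.diag_apply, Finset.mul_sum]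
  refine Finset.sum_congr rfl fun i _ => ?_
  have h3 : ∀ j, l (Matrix.single i j (x i j)) = x i j * l (Matrix.single i j 1) := fun j => by
    rw [← smul_eq_mul, ← map_smul, Matrix.smul_single, smul_eq_mul, mul_one]
  rw [Finset.sum_eq_single i, h3, h2 i i₀, mul_comm]
  · intro j _ hj
    rw [h3, h1 i j hj.symm, mul_zero]
  · simp

/-- Automorphisms of a matrix algebra are inner. -/
lemma exists_conj_eq (f : Matrix ι ι ℂ ≃ₐ[ℂ] Matrix ι ι ℂ) :
    ∃ P P' : Matrix ι ι ℂ, P * P' = 1 ∧ P' * P = 1 ∧ ∀ x, f x = P * x * P' := by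
  obtain ⟨T, hT⟩ := ((Matrix.toLinAlgEquiv'.symm.trans f).trans
    Matrix.toLinAlgEquiv').eq_linearEquivConjAlgEquiv
  refine ⟨LinearMap.toMatrixAlgEquiv' T.toLinearMap, LinearMap.toMatrixAlgEquiv' T.symm.toLinearMap,
    ?_, ?_, fun x => ?_⟩
  · rw [← LinearMap.toMatrixAlgEquiv'_comp]; simp
  · rw [← LinearMap.toMatrixAlgEquiv'_comp]; simp
  · have h := AlgEquiv.congr_fun hT (Matrix.toLinAlgEquiv' x)
    apply Matrix.toLinAlgEquiv'.injective
    simp only [AlgEquiv.trans_apply, AlgEquiv.symm_apply_apply, LinearEquiv.conjAlgEquiv_apply] at h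
    rw [h, map_mul, map_mul]
    simp only [Matrix.toLinAlgEquiv'_toMatrixAlgEquiv']
    rfl

/-- A linear involution reversing products of a matrix algebra is `x ↦ P xᵀ P⁻¹` with `P` symmetric
or skew-symmetric. -/
lemma exists_involution_eq [Nonempty ι] (τ : Matrix ι ι ℂ →ₗ[ℂ] Matrix ι ι ℂ)
    (hτ : ∀ x, τ (τ x) = x) (hmul : ∀ x y, τ (x * y) = τ y * τ x) :
    ∃ P P' : Matrix ι ι ℂ, P * P' = 1 ∧ P' * P = 1 ∧ (P.transpose = P ∨ P.transpose = -P) ∧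
      ∀ x, τ x = P * x.transpose * P' := by
  have hone : τ 1 = 1 := by
    have := hmul (τ 1) 1
    rw [mul_one, hτ, mul_one] at this
    exact this.symm
  -- Composing with transposition makes τ an automorphism, hence inner.
  let g : Matrix ι ι ℂ →ₐ[ℂ] Matrix ι ι ℂ := AlgHom.ofLinearMap
    (τ ∘ₗ (Matrix.transposeLinearEquiv ι ι ℂ ℂ).toLinearMap)
    (by simp [hone]) (fun x y => by simp [hmul])
  have hg : ∀ x, g x = τ x.transpose := fun x => rfl
  have hbij : Function.Bijective g := by
    constructor
    · intro x y hxy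
      rw [hg, hg] at hxy
      have := congrArg τ hxy
      rw [hτ, hτ] at this
      exact Matrix.transpose_injective this
    · intro x
      exact ⟨(τ x).transpose, by rw [hg, Matrix.transpose_transpose, hτ]⟩
  obtain ⟨P, P', h1, h2, hP⟩ := exists_conj_eq (AlgEquiv.ofBijective g hbij)
  have hP' : ∀ x, τ x = P * x.transpose * P' := fun x => by
    rw [← hP, AlgEquiv.ofBijective_apply, hg, Matrix.transpose_transpose]
  refine ⟨P, P', h1, h2, ?_, hP'⟩
  have h1t : P'.transpose * P.transpose = 1 := by
    rw [← Matrix.transpose_mul, h1, Matrix.transpose_one]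
  have h2t : P.transpose * P'.transpose = 1 := by
    rw [← Matrix.transpose_mul, h2, Matrix.transpose_one]
  -- This is τ² = 1 written out. So P (Pᵗ)⁻¹ is a scalar c, and transposing P = c Pᵗ once more gives
  -- c² = 1.
  have hcomm : ∀ x, P * P'.transpose * x = x * (P * P'.transpose) := fun x => by
    have h3 := hτ x
    rw [hP', hP', Matrix.transpose_mul, Matrix.transpose_mul, Matrix.transpose_transpose] at h3
    calc P * P'.transpose * x
        = P * P'.transpose * x * (P.transpose * P'.transpose) := by rw [h2t, mul_one]
      _ = (P * (P'.transpose * (x * P.transpose)) * P') * (P * P'.transpose) := by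
          rw [mul_assoc _ P' , ← mul_assoc P' P, h2, one_mul]
          simp only [mul_assoc]
      _ = _ := by rw [h3]
  have hc : P * P'.transpose ∈ Set.center (Matrix ι ι ℂ) :=
    Semigroup.mem_center_iff.mpr fun g => (hcomm g).symm
  rw [Matrix.center_eq_range] at hc
  obtain ⟨c, hc⟩ := hc
  have h4 : P = c • P.transpose := by
    have : P * P'.transpose * P.transpose = P := by rw [mul_assoc, h1t, mul_one]
    conv_lhs => rw [← this, ← hc]
    rw [Matrix.scalar_apply, Matrix.smul_eq_diagonal_mul]
  have h5 : P = (c * c) • P := by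
    conv_lhs => rw [h4]
    have := congrArg Matrix.transpose h4
    rw [Matrix.transpose_smul, Matrix.transpose_transpose] at this
    rw [this, smul_smul]
  have hP0 : P ≠ 0 := by
    rintro rfl
    rw [zero_mul] at h1
    exact zero_ne_one h1
  have h6 : c * c = 1 := by
    have : (c * c - 1) • P = 0 := by rw [sub_smul, one_smul, ← h5, sub_self]
    rcases smul_eq_zero.mp this with h | h
    · exact sub_eq_zero.mp h
    · exact absurd h hP0
  rcases mul_self_eq_one_iff.mp h6 with rfl | rfl
  · left; rw [one_smul] at h4; exact h4.symm
  · right; rw [neg_one_smul] at h4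
    rw [← neg_eq_iff_eq_neg]; exact h4.symm

end MatrixForms

/-! ### Orthonormal and symplectic bases -/

section GramFamilies

variable {V : Type*} [AddCommGroup V] [Module ℂ V] {κ : Type*} [Fintype κ] [DecidableEq κ]

lemma linearIndependent_of_gram (B : V →ₗ[ℂ] V →ₗ[ℂ] ℂ) {b : κ → V} {S S' : Matrix κ κ ℂ}
    (hS : S * S' = 1) (hb : ∀ i j, B (b i) (b j) = S i j) : LinearIndependent ℂ b := by
  rw [Fintype.linearIndependent_iff]
  intro c hc i
  have h1 : Matrix.vecMul c S = 0 := by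
    funext j
    have := congrArg (fun v => B v (b j)) hc
    simpa [hb, Matrix.vecMul, dotProduct] using this
  have h2 : Matrix.vecMul (Matrix.vecMul c S) S' = c := by
    rw [Matrix.vecMul_vecMul, hS, Matrix.vecMul_one]
  rw [h1, Matrix.zero_vecMul] at h2
  exact (congrFun h2 i).symm

/-- Orthogonal projection onto the span of b: the coefficients are the row (B(v, bⱼ)) multiplied by
S⁻¹. -/
lemma exists_sub_mem_span_orthogonal (B : V →ₗ[ℂ] V →ₗ[ℂ] ℂ) {b : κ → V} {S S' : Matrix κ κ ℂ}
    (hS : S' * S = 1) (hb : ∀ i j, B (b i) (b j) = S i j) (v : V) :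
    ∃ s ∈ Submodule.span ℂ (Set.range b), ∀ j, B (v - s) (b j) = 0 := by
  set c := Matrix.vecMul (fun j => B v (b j)) S' with hc
  refine ⟨∑ i, c i • b i, Submodule.sum_mem _ fun i _ =>
    Submodule.smul_mem _ _ (Submodule.subset_span ⟨i, rfl⟩), fun j => ?_⟩
  have h1 : Matrix.vecMul c S = fun j => B v (b j) := by
    rw [hc, Matrix.vecMul_vecMul, hS, Matrix.vecMul_one]
  have h2 := congrFun h1 j
  simp only [Matrix.vecMul, dotProduct] at h2
  simp [hb, h2]

/-- A family with invertible Gram matrix that is too small to span has a hyperbolic pair in its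
orthogonal complement. -/
lemma exists_orthogonal_pair [Module.Finite ℂ V] (B : V →ₗ[ℂ] V →ₗ[ℂ] ℂ)
    (hB : ∀ v, (∀ w, B v w = 0) → v = 0)
    {b : κ → V} {S S' : Matrix κ κ ℂ} (hS : S' * S = 1) (hb : ∀ i j, B (b i) (b j) = S i j)
    (hcard : Fintype.card κ < Module.finrank ℂ V) :
    ∃ x y, B x y = 1 ∧ (∀ j, B x (b j) = 0) ∧ ∀ j, B y (b j) = 0 := by
  have hspan : Submodule.span ℂ (Set.range b) ≠ ⊤ := fun h => by
    have h1 := finrank_range_le_card (R := ℂ) b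
    rw [Set.finrank, h, finrank_top] at h1
    omega
  obtain ⟨v, hv⟩ : ∃ v, v ∉ Submodule.span ℂ (Set.range b) := by
    by_contra! h
    exact hspan (eq_top_iff.mpr fun v _ => h v)
  obtain ⟨s, hs, hsv⟩ := exists_sub_mem_span_orthogonal B hS hb v
  have hne : v - s ≠ 0 := fun h => hv (by rwa [sub_eq_zero.mp h])
  obtain ⟨w, hw⟩ : ∃ w, B (v - s) w ≠ 0 := by
    by_contra! h
    exact hne (hB _ h)
  -- Removing from w its component in the span does not change its pairing with v - s, which is
  -- orthogonal to the span.
  obtain ⟨t, ht, htw⟩ := exists_sub_mem_span_orthogonal B hS hb w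
  have hst : B (v - s) t = 0 := by
    have : Submodule.span ℂ (Set.range b) ≤ LinearMap.ker (B (v - s)) := by
      rw [Submodule.span_le]
      rintro _ ⟨j, rfl⟩
      exact hsv j
    exact this ht
  refine ⟨v - s, (B (v - s) w)⁻¹ • (w - t), ?_, hsv, fun j => ?_⟩
  · rw [map_smul, map_sub (B (v - s)), hst, sub_zero, smul_eq_mul, inv_mul_cancel₀ hw]
  · rw [map_smul, LinearMap.smul_apply, htw, smul_zero]

lemma exists_orthonormal_family [Module.Finite ℂ V] (B : V →ₗ[ℂ] V →ₗ[ℂ] ℂ)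
    (hsymm : ∀ v w, B w v = B v w) (hB : ∀ v, (∀ w, B v w = 0) → v = 0) (m : ℕ)
    (hm : m ≤ Module.finrank ℂ V) :
    ∃ b : Fin m → V, ∀ i j, B (b i) (b j) = (1 : Matrix (Fin m) (Fin m) ℂ) i j := by
  induction m with
  | zero => exact ⟨Fin.elim0, fun i => i.elim0⟩
  | succ m ih =>
    obtain ⟨b, hb⟩ := ih (by omega)
    obtain ⟨x, y, hxy, hx, hy⟩ := exists_orthogonal_pair B hB
      (mul_one 1) hb (by rw [Fintype.card_fin]; omega)
    -- If x and y are both isotropic, then B(x + y, x + y) = 2 B(x, y) = 2. A square root in ℂ then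
    -- normalises u.
    obtain ⟨u, hu, hub⟩ : ∃ u, B u u ≠ 0 ∧ ∀ j, B u (b j) = 0 := by
      by_cases h1 : B x x = 0
      · by_cases h2 : B y y = 0
        · refine ⟨x + y, ?_, fun j => by simp [hx, hy]⟩
          simp [h1, h2, hxy, hsymm x y]
        · exact ⟨y, h2, hy⟩
      · exact ⟨x, h1, hx⟩
    obtain ⟨r, hr⟩ := IsAlgClosed.exists_pow_nat_eq (B u u) (n := 2) (by norm_num)
    have hr0 : r ≠ 0 := by
      rintro rfl
      exact hu (by rw [← hr]; norm_num)
    refine ⟨Fin.cons (r⁻¹ • u) b, fun i j => ?_⟩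
    refine Fin.cases ?_ (fun i => ?_) i <;> refine Fin.cases ?_ (fun j => ?_) j
    · simp only [Fin.cons_zero, map_smul, LinearMap.smul_apply, smul_eq_mul, ← hr]
      rw [Matrix.one_apply_eq]
      field_simp
    · simp [hub, (Fin.succ_ne_zero j).symm]
    · simp [hsymm u, hub]
    · simp [hb, Matrix.one_apply]

/-- The block-diagonal matrix with blocks `(0, 1; -1, 0)`. -/
def symplecticJ (n : ℕ) : Matrix (Fin n × Fin 2) (Fin n × Fin 2) ℂ :=
  Matrix.comp _ _ _ _ _ (Matrix.diagonal fun _ : Fin n => !![0, 1; -1, 0])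

lemma symplecticJ_mul_neg (n : ℕ) : symplecticJ n * -symplecticJ n = 1 := by
  have h : symplecticJ n = Matrix.compAlgEquiv (Fin n) (Fin 2) ℂ ℂ
      (Matrix.diagonal fun _ : Fin n => !![0, 1; -1, 0]) := rfl
  have hJ : (!![0, 1; -1, 0] * !![0, 1; -1, 0] : Matrix (Fin 2) (Fin 2) ℂ) = -1 := by
    ext a b
    fin_cases a <;> fin_cases b <;> simp
  rw [h, ← map_neg, ← map_mul, ← map_one (Matrix.compAlgEquiv (Fin n) (Fin 2) ℂ ℂ), mul_neg,
    Matrix.diagonal_mul_diagonal, hJ]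
  congr 1
  ext i j : 2
  by_cases hij : i = j
  · subst hij; simp
  · simp [hij]

lemma exists_symplectic_family [Module.Finite ℂ V] (B : V →ₗ[ℂ] V →ₗ[ℂ] ℂ)
    (hskew : ∀ v w, B w v = -B v w) (hB : ∀ v, (∀ w, B v w = 0) → v = 0) :
    ∃ (n : ℕ) (b : Fin n × Fin 2 → V), n * 2 = Module.finrank ℂ V ∧
      ∀ i j, B (b i) (b j) = symplecticJ n i j := by
  -- If no symplectic family has exactly dim V members, each can be enlarged by a hyperbolic pair,
  -- without end; invertible Gram matrices make all of them linearly independent.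
  by_contra! hcon
  have key : ∀ n : ℕ, ∃ b : Fin n × Fin 2 → V, ∀ i j, B (b i) (b j) = symplecticJ n i j := by
    intro n
    induction n with
    | zero => exact ⟨fun i => i.1.elim0, fun i => i.1.elim0⟩
    | succ n ih =>
      obtain ⟨b, hb⟩ := ih
      have hle := (linearIndependent_of_gram B (symplecticJ_mul_neg n) hb).fintype_card_le_finrank
      have hcard : Fintype.card (Fin n × Fin 2) = n * 2 := by simp
      have hne : n * 2 ≠ Module.finrank ℂ V := fun h => by
        obtain ⟨i, j, hij⟩ := hcon n b h
        exact hij (hb i j)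
      obtain ⟨x, y, hxy, hx, hy⟩ := exists_orthogonal_pair B hB
        (S' := -symplecticJ n) (by rw [neg_mul, ← mul_neg, symplecticJ_mul_neg]) hb (by omega)
      have hself : ∀ v, B v v = 0 := fun v => self_eq_neg.mp (hskew v v)
      refine ⟨fun p => Fin.cases (![x, y] p.2) (fun i => b (i, p.2)) p.1, ?_⟩
      rintro ⟨i, s⟩ ⟨j, t⟩
      refine Fin.cases ?_ (fun i => ?_) i <;> refine Fin.cases ?_ (fun j => ?_) j
      · fin_cases s <;> fin_cases t <;> simp [hself, hxy, hskew x y, symplecticJ]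
      · fin_cases s <;> simp [hx, hy, symplecticJ, (Fin.succ_ne_zero j).symm]
      · fin_cases t <;> simp [hskew x, hskew y, hx, hy, symplecticJ]
      · simp only [Fin.cases_succ, hb]
        simp [symplecticJ, Matrix.diagonal_apply]
  obtain ⟨b, hb⟩ := key (Module.finrank ℂ V + 1)
  have := (linearIndependent_of_gram B (symplecticJ_mul_neg _) hb).fintype_card_le_finrank
  simp at this
  omega

end GramFamilies

/-! ### Classification of involutions of Mat_N(ℂ) -/

section MatrixInvolutions

/-- The equivalence is h(x) = Q x Q⁻¹: a change of basis taking P to Q P Qᵗ = S takes x ↦ P xᵗ P⁻¹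
to y ↦ S yᵗ S⁻¹. The inverse R of Q is read off from the congruence. -/
lemma exists_algEquiv_of_congruence {ι κ : Type*} [Fintype ι] [DecidableEq ι] [Fintype κ]
    [DecidableEq κ] (hcard : Fintype.card κ = Fintype.card ι) {P P' : Matrix ι ι ℂ}
    {S S' : Matrix κ κ ℂ} {Q : Matrix κ ι ℂ} (hP : P' * P = 1) (hS : S * S' = 1)
    (hQ : Q * P * Q.transpose = S) :
    ∃ h : Matrix ι ι ℂ ≃ₐ[ℂ] Matrix κ κ ℂ,
      ∀ x, h (P * x.transpose * P') = S * (h x).transpose * S' := by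
  obtain ⟨R, hR⟩ : ∃ R, R = P * Q.transpose * S' := ⟨_, rfl⟩
  have h1 : Q * R = 1 := by rw [hR, ← Matrix.mul_assoc, ← Matrix.mul_assoc, hQ, hS]
  have h2 : R * Q = 1 := (Matrix.mul_eq_one_comm_of_card_eq κ ι ℂ hcard).mp h1
  refine ⟨AlgEquiv.ofAlgHom
    (AlgHom.ofLinearMap
      { toFun := fun x => Q * x * R
        map_add' := fun x y => by rw [Matrix.mul_add, Matrix.add_mul]
        map_smul' := fun c x => by simp }
      (by simp [h1])
      (fun x y => by
        change Q * (x * y) * R = Q * x * R * (Q * y * R)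
        rw [Matrix.mul_assoc (Q * x), ← Matrix.mul_assoc R, ← Matrix.mul_assoc R, h2,
          Matrix.one_mul]
        simp only [Matrix.mul_assoc]))
    (AlgHom.ofLinearMap
      { toFun := fun x => R * x * Q
        map_add' := fun x y => by rw [Matrix.mul_add, Matrix.add_mul]
        map_smul' := fun c x => by simp }
      (by simp [h2])
      (fun x y => by
        change R * (x * y) * Q = R * x * Q * (R * y * Q)
        rw [Matrix.mul_assoc (R * x), ← Matrix.mul_assoc Q, ← Matrix.mul_assoc Q, h1,
          Matrix.one_mul]
        simp only [Matrix.mul_assoc]))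
    (AlgHom.ext fun x => by
      change Q * (R * x * Q) * R = x
      rw [← Matrix.mul_assoc, ← Matrix.mul_assoc, h1, Matrix.one_mul, Matrix.mul_assoc, h1,
        Matrix.mul_one])
    (AlgHom.ext fun x => by
      change R * (Q * x * R) * Q = x
      rw [← Matrix.mul_assoc, ← Matrix.mul_assoc, h2, Matrix.one_mul, Matrix.mul_assoc, h2,
        Matrix.mul_one]), fun x => ?_⟩
  change Q * (P * x.transpose * P') * R = S * (Q * x * R).transpose * S'
  have h3 : Q * P = S * R.transpose := by
    rw [← hQ, Matrix.mul_assoc, ← Matrix.transpose_mul, h2, Matrix.transpose_one, Matrix.mul_one]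
  have h4 : P' * R = Q.transpose * S' := by
    rw [hR, ← Matrix.mul_assoc, ← Matrix.mul_assoc, hP, Matrix.one_mul]
  rw [Matrix.transpose_mul, Matrix.transpose_mul]
  calc Q * (P * x.transpose * P') * R = (Q * P) * x.transpose * (P' * R) := by
        simp only [Matrix.mul_assoc]
    _ = _ := by rw [h3, h4]; simp only [Matrix.mul_assoc]

/-- Involutions reversing products of a complex matrix algebra are, up to isomorphism, the
transposition or the symplectic involution. -/
theorem involution_classification {N : ℕ} (hN : 0 < N)
    (τ : Matrix (Fin N) (Fin N) ℂ →ₗ[ℂ] Matrix (Fin N) (Fin N) ℂ)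
    (hτ : ∀ x, τ (τ x) = x) (hmul : ∀ x y, τ (x * y) = τ y * τ x) :
    (∃ h : Matrix (Fin N) (Fin N) ℂ ≃ₐ[ℂ] Matrix (Fin N) (Fin N) ℂ,
      ∀ x, h (τ x) = (h x).transpose) ∨
    ∃ n, 0 < n ∧ ∃ h : Matrix (Fin N) (Fin N) ℂ ≃ₐ[ℂ] Matrix (Fin n × Fin 2) (Fin n × Fin 2) ℂ,
      ∀ x, h (τ x) = symplecticJ n * (h x).transpose * -symplecticJ n := by
  have : Nonempty (Fin N) := ⟨⟨0, hN⟩⟩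
  obtain ⟨P, P', h1, h2, hP, hτP⟩ := exists_involution_eq τ hτ hmul
  -- The bilinear form with matrix P. It is symmetric or alternating, and an adapted basis supplies
  -- the rows of Q.
  let B : (Fin N → ℂ) →ₗ[ℂ] (Fin N → ℂ) →ₗ[ℂ] ℂ := Matrix.toLinearMap₂' ℂ P
  have hBapp : ∀ v w, B v w = v ⬝ᵥ P.mulVec w := fun v w => Matrix.toLinearMap₂'_apply' P v w
  have hB : ∀ v, (∀ w, B v w = 0) → v = 0 := fun v hv => by
    have h3 : Matrix.vecMul v P = 0 := by
      funext j
      have := hv (Pi.single j 1)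
      rwa [hBapp, Matrix.dotProduct_mulVec, dotProduct_single, mul_one] at this
    rw [← Matrix.vecMul_one v, ← h1, ← Matrix.vecMul_vecMul, h3, Matrix.zero_vecMul]
  have hflip : ∀ v w, B w v = v ⬝ᵥ P.transpose.mulVec w := fun v w => by
    rw [hBapp, Matrix.mulVec_transpose, Matrix.dotProduct_mulVec, dotProduct_comm]
  have hgram : ∀ {κ : Type} [Fintype κ] (b : κ → Fin N → ℂ) (i j : κ),
      (Matrix.of b * P * (Matrix.of b).transpose) i j = B (b i) (b j) := fun b i j => by
    rw [hBapp, Matrix.dotProduct_mulVec]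
    rfl
  simp only [hτP]
  rcases hP with hP | hP
  · left
    obtain ⟨b, hb⟩ := exists_orthonormal_family B (fun v w => by rw [hflip, hP, hBapp]) hB N
      (by simp)
    obtain ⟨h, hh⟩ := exists_algEquiv_of_congruence rfl (Q := Matrix.of b) h2
      (one_mul (1 : Matrix (Fin N) (Fin N) ℂ)) (by ext i j; rw [hgram, hb])
    exact ⟨h, fun x => by rw [hh, one_mul, mul_one]⟩
  · right
    obtain ⟨n, b, hn, hb⟩ := exists_symplectic_family B
      (fun v w => by rw [hflip, hP, hBapp, Matrix.neg_mulVec, dotProduct_neg]) hB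
    rw [Module.finrank_fin_fun] at hn
    obtain ⟨h, hh⟩ := exists_algEquiv_of_congruence (by simp [hn]) (Q := Matrix.of b) h2
      (symplecticJ_mul_neg n) (by ext i j; rw [hgram, hb])
    exact ⟨n, by omega, h, hh⟩

end MatrixInvolutions

/-! ### The complexified models as complex matrix algebras -/

section SplitModels

/-- Criterion for V to be a real form of W: spanning gives surjectivity, equality of dimensions
gives injectivity. -/
lemma liftEquiv_bijective {V W : Type*} [Ring V] [Algebra ℝ V] [Module.Finite ℝ V] [Ring W]
    [Algebra ℂ W] [Algebra ℝ W] [@IsScalarTower ℝ ℂ W _ _ Algebra.toSMul] [Module.Finite ℂ W] (f : V →ₐ[ℝ] W)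
    (hspan : Submodule.span ℂ (Set.range f) = ⊤)
    (hrank : Module.finrank ℝ V = Module.finrank ℂ W) :
    Function.Bijective (AlgHom.liftEquiv ℝ ℂ V W f) := by
  have hsurj : Function.Surjective (AlgHom.liftEquiv ℝ ℂ V W f).toLinearMap := by
    rw [← LinearMap.range_eq_top, eq_top_iff, ← hspan, Submodule.span_le]
    rintro _ ⟨v, rfl⟩
    exact ⟨1 ⊗ₜ[ℝ] v, by simp⟩
  exact ⟨(LinearMap.injective_iff_surjective_of_finrank_eq_finrank
    (by rw [Module.finrank_baseChange, hrank])).mpr hsurj, hsurj⟩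

lemma span_range_mapMatrix {D W : Type*} [Ring D] [Algebra ℝ D] [Ring W] [Algebra ℂ W]
    [Algebra ℝ W] (ψ : D →ₐ[ℝ] W)
    (hψ : Submodule.span ℂ (Set.range ψ) = ⊤) (n : ℕ) :
    Submodule.span ℂ (Set.range (ψ.mapMatrix : Matrix (Fin n) (Fin n) D →ₐ[ℝ] _)) = ⊤ := by
  rw [eq_top_iff]
  intro X _
  rw [Matrix.matrix_eq_sum_single X]
  refine Submodule.sum_mem _ fun i _ => Submodule.sum_mem _ fun j _ => ?_
  have h : X i j ∈ Submodule.span ℂ (Set.range ψ) := hψ ▸ Submodule.mem_top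
  have h1 := Submodule.mem_map_of_mem (f := Matrix.singleLinearMap ℂ i j) h
  rw [Submodule.map_span] at h1
  refine Submodule.span_mono ?_ h1
  rintro _ ⟨_, ⟨d, rfl⟩, rfl⟩
  exact ⟨Matrix.single i j d, by simp [AlgHom.mapMatrix_apply]⟩

lemma exists_realModelEquiv (n : ℕ) :
    ∃ ρ : ℂ ⊗[ℝ] Matrix (Fin n) (Fin n) ℝ ≃ₐ[ℂ] Matrix (Fin n) (Fin n) ℂ,
      ∀ x, ρ ((matrixConj ℝ n).baseChange ℂ x) = (ρ x).transpose := by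
  let f : Matrix (Fin n) (Fin n) ℝ →ₐ[ℝ] Matrix (Fin n) (Fin n) ℂ :=
    (Algebra.ofId ℝ ℂ).mapMatrix
  have hspan : Submodule.span ℂ (Set.range f) = ⊤ := by
    refine span_range_mapMatrix _ ?_ n
    rw [eq_top_iff]
    intro z _
    rw [← mul_one z, ← smul_eq_mul]
    exact Submodule.smul_mem _ _ (Submodule.subset_span ⟨1, map_one _⟩)
  refine ⟨AlgEquiv.ofBijective _ (liftEquiv_bijective f hspan (by simp [Module.finrank_matrix])),
    fun x => ?_⟩
  induction x with
  | zero => simp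
  | add x y hx hy => simp only [map_add, hx, hy, Matrix.transpose_add]
  | tmul z X =>
    change z • f X.conjTranspose = (z • f X).transpose
    ext i j
    simp [f]

lemma exists_complexModelEquiv (n : ℕ) :
    ∃ ρ : ℂ ⊗[ℝ] Matrix (Fin n) (Fin n) ℂ ≃ₐ[ℂ]
        Matrix (Fin n) (Fin n) ℂ × Matrix (Fin n) (Fin n) ℂ,
      ∀ x, ρ ((matrixConj ℂ n).baseChange ℂ x) = ((ρ x).2.transpose, (ρ x).1.transpose) := by
  -- The embedding X ↦ (X, X̄). As X^* = (X̄)ᵗ, conjugate transposition becomes the swap followed by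
  -- transposition.
  let f : Matrix (Fin n) (Fin n) ℂ →ₐ[ℝ] Matrix (Fin n) (Fin n) ℂ × Matrix (Fin n) (Fin n) ℂ :=
    (AlgHom.id ℝ _).prod (Complex.conjAe.toAlgHom.mapMatrix)
  have hf : ∀ X, f X = (X, X.map (starRingEnd ℂ)) := fun X => rfl
  have hspan : Submodule.span ℂ (Set.range f) = ⊤ := by
    rw [eq_top_iff]
    rintro ⟨X, Y⟩ -
    -- The combination f(X) - i f(iX) is (2X, 0), because the second component is conjugate-linear;
    -- likewise f(Ȳ) + i f(iȲ) = (0, 2Y).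
    have h : (X, Y) = (1 / 2 : ℂ) • f X - (Complex.I / 2) • f (Complex.I • X) +
        ((1 / 2 : ℂ) • f (Y.map (starRingEnd ℂ)) +
          (Complex.I / 2) • f (Complex.I • Y.map (starRingEnd ℂ))) := by
      simp only [hf]
      have hI : ∀ z : ℂ, Complex.I * (Complex.I * z) = -z := fun z => by
        rw [← mul_assoc, Complex.I_mul_I, neg_one_mul]
      refine Prod.ext ?_ ?_
      · ext i j
        simp only [Prod.fst_add, Prod.fst_sub, Prod.smul_fst, Matrix.add_apply, Matrix.sub_apply,
          Matrix.smul_apply, smul_eq_mul, Matrix.map_apply, div_mul_eq_mul_div, hI]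
        ring
      · ext i j
        simp only [Prod.snd_add, Prod.snd_sub, Prod.smul_snd, Matrix.add_apply, Matrix.sub_apply,
          Matrix.smul_apply, smul_eq_mul, Matrix.map_apply, map_mul, Complex.conj_I, neg_mul,
          mul_neg, Complex.conj_conj, div_mul_eq_mul_div, hI]
        ring
    rw [h]
    exact Submodule.add_mem _ (Submodule.sub_mem _
      (Submodule.smul_mem _ _ (Submodule.subset_span ⟨_, rfl⟩))
      (Submodule.smul_mem _ _ (Submodule.subset_span ⟨_, rfl⟩))) (Submodule.add_mem _
      (Submodule.smul_mem _ _ (Submodule.subset_span ⟨_, rfl⟩))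
      (Submodule.smul_mem _ _ (Submodule.subset_span ⟨_, rfl⟩)))
  refine ⟨AlgEquiv.ofBijective _ (liftEquiv_bijective f hspan
    (by simp [Module.finrank_matrix, mul_two])), fun x => ?_⟩
  induction x with
  | zero => simp [Prod.mk_zero_zero]
  | add x y hx hy => simp only [map_add, hx, hy, Prod.snd_add, Prod.fst_add, Matrix.transpose_add,
      Prod.mk_add_mk]
  | tmul z X =>
    change z • f X.conjTranspose = ((z • f X).2.transpose, (z • f X).1.transpose)
    rw [hf, hf]
    refine Prod.ext ?_ ?_ <;> ext i j <;> simp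

/-- The representation of quaternions by complex `2 × 2` matrices. -/
def quaternionMatrix : ℍ[ℝ] →ₐ[ℝ] Matrix (Fin 2) (Fin 2) ℂ where
  toFun q := !![⟨q.re, q.imI⟩, ⟨q.imJ, q.imK⟩; ⟨-q.imJ, q.imK⟩, ⟨q.re, -q.imI⟩]
  map_one' := by
    ext i j
    fin_cases i <;> fin_cases j <;> apply Complex.ext <;> simp
  map_zero' := by
    ext i j
    fin_cases i <;> fin_cases j <;> apply Complex.ext <;> simp
  map_add' x y := by
    ext i j
    fin_cases i <;> fin_cases j <;> apply Complex.ext <;> simp <;> ring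
  map_mul' x y := by
    ext i j
    fin_cases i <;> fin_cases j <;> apply Complex.ext <;> simp [Matrix.mul_apply] <;> ring
  commutes' r := by
    ext i j
    fin_cases i <;> fin_cases j <;> apply Complex.ext <;> simp [Matrix.algebraMap_matrix_apply]

lemma quaternionMatrix_apply (q : ℍ[ℝ]) : quaternionMatrix q =
    !![⟨q.re, q.imI⟩, ⟨q.imJ, q.imK⟩; ⟨-q.imJ, q.imK⟩, ⟨q.re, -q.imI⟩] := rfl

lemma adjugate_fin_two_eq (M : Matrix (Fin 2) (Fin 2) ℂ) :
    !![0, 1; -1, 0] * M.transpose * -!![0, 1; -1, 0] = !![M 1 1, -M 0 1; -M 1 0, M 0 0] := by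
  have h : M.transpose = !![M 0 0, M 1 0; M 0 1, M 1 1] := Matrix.eta_fin_two M.transpose
  rw [h]
  ext i j
  fin_cases i <;> fin_cases j <;> simp

/-- Quaternion conjugation becomes the adjugate of a 2 × 2 matrix, which is M ↦ J Mᵗ J⁻¹ with J⁻¹ =
-J. -/
lemma quaternionMatrix_star (q : ℍ[ℝ]) : quaternionMatrix (star q) =
    !![0, 1; -1, 0] * (quaternionMatrix q).transpose * -!![0, 1; -1, 0] := by
  rw [adjugate_fin_two_eq, quaternionMatrix_apply, quaternionMatrix_apply]
  ext i j
  fin_cases i <;> fin_cases j <;> apply Complex.ext <;> simp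

lemma span_range_quaternionMatrix : Submodule.span ℂ (Set.range quaternionMatrix) = ⊤ := by
  rw [eq_top_iff]
  intro X _
  -- The units 1, i, j, k are represented by the identity, diag(i, -i), J and i times the exchange
  -- matrix, a complex basis of Mat₂(ℂ).
  have h : X = ((X 0 0 + X 1 1) / 2) • quaternionMatrix (⟨1, 0, 0, 0⟩ : ℍ[ℝ]) +
      ((X 0 0 - X 1 1) / (2 * Complex.I)) • quaternionMatrix (⟨0, 1, 0, 0⟩ : ℍ[ℝ]) +
      (((X 0 1 - X 1 0) / 2) • quaternionMatrix (⟨0, 0, 1, 0⟩ : ℍ[ℝ]) +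
      ((X 0 1 + X 1 0) / (2 * Complex.I)) • quaternionMatrix (⟨0, 0, 0, 1⟩ : ℍ[ℝ])) := by
    have h1 : (⟨1, 0⟩ : ℂ) = 1 := rfl
    have h2 : (⟨0, 1⟩ : ℂ) = Complex.I := rfl
    have h3 : (⟨0, 0⟩ : ℂ) = 0 := rfl
    have h4 : (⟨-1, 0⟩ : ℂ) = -1 := by apply Complex.ext <;> simp
    have h5 : (⟨0, -1⟩ : ℂ) = -Complex.I := by apply Complex.ext <;> simp
    have hI := Complex.I_ne_zero
    have hq : ∀ a b c d : ℝ, quaternionMatrix (⟨a, b, c, d⟩ : ℍ[ℝ]) =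
      !![⟨a, b⟩, ⟨c, d⟩; ⟨-c, d⟩, ⟨a, -b⟩] := fun _ _ _ _ => rfl
    simp only [hq, neg_zero]
    ext i j
    fin_cases i <;> fin_cases j <;> simp [h1, h2, h3, h4, h5] <;> field_simp <;> ring
  rw [h]
  exact Submodule.add_mem _ (Submodule.add_mem _
    (Submodule.smul_mem _ _ (Submodule.subset_span ⟨_, rfl⟩))
    (Submodule.smul_mem _ _ (Submodule.subset_span ⟨_, rfl⟩))) (Submodule.add_mem _
    (Submodule.smul_mem _ _ (Submodule.subset_span ⟨_, rfl⟩))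
    (Submodule.smul_mem _ _ (Submodule.subset_span ⟨_, rfl⟩)))

lemma exists_quaternionModelEquiv (n : ℕ) :
    ∃ ρ : ℂ ⊗[ℝ] Matrix (Fin n) (Fin n) ℍ[ℝ] ≃ₐ[ℂ] Matrix (Fin n × Fin 2) (Fin n × Fin 2) ℂ,
      ∀ x, ρ ((matrixConj ℍ[ℝ] n).baseChange ℂ x) =
        symplecticJ n * (ρ x).transpose * -symplecticJ n := by
  let f : Matrix (Fin n) (Fin n) ℍ[ℝ] →ₐ[ℝ] Matrix (Fin n) (Fin n) (Matrix (Fin 2) (Fin 2) ℂ) :=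
    quaternionMatrix.mapMatrix
  have hspan : Submodule.span ℂ (Set.range f) = ⊤ :=
    span_range_mapMatrix _ span_range_quaternionMatrix n
  let C := Matrix.compAlgEquiv (Fin n) (Fin 2) ℂ ℂ
  refine ⟨(AlgEquiv.ofBijective _ (liftEquiv_bijective f hspan (by
    simp [Module.finrank_matrix, Quaternion.finrank_eq_four]))).trans C, fun x => ?_⟩
  induction x with
  | zero => simp
  | add x y hx hy =>
    simp only [map_add, hx, hy, Matrix.transpose_add, Matrix.mul_add, Matrix.add_mul]
  | tmul z X =>
    change C (z • f X.conjTranspose) = symplecticJ n * (C (z • f X)).transpose * -symplecticJ n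
    have hJ : symplecticJ n = C (Matrix.diagonal fun _ => !![0, 1; -1, 0]) := rfl
    -- Transposing the flattened matrix transposes both the positions of the blocks and the blocks
    -- themselves.
    have hT : ∀ Y : Matrix (Fin n) (Fin n) (Matrix (Fin 2) (Fin 2) ℂ),
        (C Y).transpose = C (Y.transpose.map Matrix.transpose) := fun Y => rfl
    rw [hT, hJ, ← map_neg, ← map_mul, ← map_mul, Matrix.diagonal_neg]
    congr 1
    refine Matrix.ext fun i j => ?_
    rw [Matrix.mul_diagonal, Matrix.diagonal_mul]
    change z • quaternionMatrix (star (X j i)) =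
      !![0, 1; -1, 0] * (z • quaternionMatrix (X j i)).transpose * -!![0, 1; -1, 0]
    rw [quaternionMatrix_star, Matrix.transpose_smul, Matrix.mul_smul, Matrix.smul_mul]

end SplitModels

/-! ### From central idempotents to models -/

section Corners

/-- A symmetric form invariant under `s` is determined by its value at `1`. -/
def HasUniqueForm (W : Type*) [Ring W] [Algebra ℂ W] (s : W →ₗ[ℂ] W) : Prop :=
  ∀ l l' : W →ₗ[ℂ] ℂ, (∀ x y, l (x * y) = l (y * x)) → (∀ x y, l' (x * y) = l' (y * x)) →
    (∀ x, l (s x) = l x) → (∀ x, l' (s x) = l' x) → l 1 = l' 1 → l = l'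

lemma hasUniqueForm_matrix {ι : Type*} [Fintype ι] [DecidableEq ι] [Nonempty ι]
    (s : Matrix ι ι ℂ →ₗ[ℂ] Matrix ι ι ℂ) : HasUniqueForm (Matrix ι ι ℂ) s := by
  intro l l' hl hl' _ _ h1
  obtain ⟨c, hc⟩ := exists_eq_smul_trace l hl
  obtain ⟨c', hc'⟩ := exists_eq_smul_trace l' hl'
  rw [hc, hc', Matrix.trace_one] at h1
  have h2 : c = c' := mul_right_cancel₀ (Nat.cast_ne_zero.mpr Fintype.card_ne_zero) h1
  exact LinearMap.ext fun x => by rw [hc, hc', h2]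

/-- On each factor the form is a multiple of the trace; invariance under the swap makes the two
multiples equal. -/
lemma hasUniqueForm_prod {ι : Type*} [Fintype ι] [DecidableEq ι] [Nonempty ι]
    (s : Matrix ι ι ℂ × Matrix ι ι ℂ →ₗ[ℂ] Matrix ι ι ℂ × Matrix ι ι ℂ)
    (hs : ∀ x, s x = (x.2.transpose, x.1.transpose)) :
    HasUniqueForm (Matrix ι ι ℂ × Matrix ι ι ℂ) s := by
  have key : ∀ l : Matrix ι ι ℂ × Matrix ι ι ℂ →ₗ[ℂ] ℂ, (∀ x y, l (x * y) = l (y * x)) →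
      (∀ x, l (s x) = l x) → ∃ c, ∀ x, l x = c * (x.1.trace + x.2.trace) := by
    intro l hl hls
    obtain ⟨c, hc⟩ := exists_eq_smul_trace (l ∘ₗ LinearMap.inl ℂ _ _) fun x y => by
      have := hl (x, 0) (y, 0)
      simpa using this
    have hc1 : ∀ x, l (x, 0) = c * x.trace := hc
    have hc2 : ∀ x, l (0, x) = c * x.trace := fun x => by
      rw [← hls, hs, ← Matrix.trace_transpose, ← hc1]
      simp
    refine ⟨c, fun x => ?_⟩
    rw [mul_add, ← hc1, ← hc2, ← map_add]
    simp
  intro l l' hl hl' hls hls' h1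
  obtain ⟨c, hc⟩ := key l hl hls
  obtain ⟨c', hc'⟩ := key l' hl' hls'
  rw [hc, hc', Prod.fst_one, Prod.snd_one, Matrix.trace_one] at h1
  have h0 : (Fintype.card ι : ℂ) + Fintype.card ι ≠ 0 := by
    rw [← two_mul]
    exact mul_ne_zero two_ne_zero (Nat.cast_ne_zero.mpr Fintype.card_ne_zero)
  have h2 : c = c' := mul_right_cancel₀ h0 h1
  exact LinearMap.ext fun x => by rw [hc, hc', h2]

variable {B : Type*} [Ring B] [Algebra ℂ B]

/-- A non-degenerate symmetric form with a compatible linear involution reversing products. -/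
structure IsStarForm (l : B →ₗ[ℂ] ℂ) (s : B →ₗ[ℂ] B) : Prop where
  symm : ∀ x y, l (x * y) = l (y * x)
  nondeg : ∀ x, (∀ y, l (x * y) = 0) → x = 0
  star_star : ∀ x, s (s x) = x
  star_mul : ∀ x y, s (x * y) = s y * s x
  form_star : ∀ x, l (s x) = l x

/-- The quotient of `B` with kernel the annihilator of `e` is a model algebra. -/
def HasModelCorner (l : B →ₗ[ℂ] ℂ) (s : B →ₗ[ℂ] B) (e : B) : Prop :=
  ∃ (D : DivisionType) (n : ℕ) (μ : ℂ) (g : B →ₐ[ℂ] (model D n μ).B), 0 < n ∧ μ ≠ 0 ∧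
    Function.Surjective g ∧ (∀ b, g b = 0 ↔ e * b = 0) ∧
    (∀ b, g (s b) = (model D n μ).starB (g b)) ∧ ∀ b, (model D n μ).lB (g b) = l (e * b)

/-- The form l(e ·) descends to W, the quotient of B isomorphic to eB. It and the model form are
symmetric and invariant, so it suffices to match their values at 1. -/
lemma exists_form_eq {l : B →ₗ[ℂ] ℂ} {s : B →ₗ[ℂ] B} (hls : IsStarForm l s) {e : B}
    (he : ∀ b, e * b = b * e) (hes : s e = e) {W : Type*} [Ring W] [Algebra ℂ W] [Nontrivial W]
    {sW : W →ₗ[ℂ] W} (hW : HasUniqueForm W sW) {π : B →ₐ[ℂ] W} (hπ : Function.Surjective π)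
    (hker : ∀ b, π b = 0 ↔ e * b = 0) (hs : ∀ b, π (s b) = sW (π b))
    {D : Type} [Ring D] [Algebra ℝ D] [StarRing D] [StarModule ℝ D] {κ : Type} [Fintype κ]
    {re : D →ₗ[ℝ] ℝ} {q : κ → D} (hq : IsUnitFrame re q) {n : ℕ} (hn : 0 < n)
    (h : W ≃ₐ[ℂ] ℂ ⊗[ℝ] Matrix (Fin n) (Fin n) D)
    (hh : ∀ w, h (sW w) = (matrixConj D n).baseChange ℂ (h w)) :
    ∃ (μ : ℂ) (g : B →ₐ[ℂ] ℂ ⊗[ℝ] Matrix (Fin n) (Fin n) D), 0 < n ∧ μ ≠ 0 ∧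
      Function.Surjective g ∧ (∀ b, g b = 0 ↔ e * b = 0) ∧
      (∀ b, g (s b) = (matrixConj D n).baseChange ℂ (g b)) ∧
      ∀ b, matrixForm re n μ (g b) = l (e * b) := by
  obtain ⟨sec, hsec⟩ := π.toLinearMap.exists_rightInverse_of_surjective
    (LinearMap.range_eq_top.mpr hπ)
  have hsec' : ∀ w, π (sec w) = w := fun w => LinearMap.congr_fun hsec w
  let lW : W →ₗ[ℂ] ℂ := l ∘ₗ LinearMap.mulLeft ℂ e ∘ₗ sec
  have hlW : ∀ b, lW (π b) = l (e * b) := fun b => by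
    change l (e * sec (π b)) = _
    rw [← sub_eq_zero, ← map_sub, ← mul_sub, (hker _).mp, map_zero]
    rw [map_sub, hsec', sub_self]
  have hlW_symm : ∀ x y, lW (x * y) = lW (y * x) := fun x y => by
    obtain ⟨x, rfl⟩ := hπ x
    obtain ⟨y, rfl⟩ := hπ y
    rw [← map_mul, ← map_mul, hlW, hlW, ← mul_assoc, hls.symm, ← mul_assoc, ← he, mul_assoc]
  have hlW_star : ∀ x, lW (sW x) = lW x := fun x => by
    obtain ⟨x, rfl⟩ := hπ x
    rw [← hs, hlW, hlW, ← hls.form_star (e * x), hls.star_mul, hes, he]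
  -- Forced at 1, where the model form takes the value nμ and `lW` the value l(e).
  set μ : ℂ := l e / n with hμ
  have hn0 : (n : ℂ) ≠ 0 := Nat.cast_ne_zero.mpr hn.ne'
  have heq : (matrixForm re n μ) ∘ₗ h.toLinearMap = lW := by
    refine hW _ _ (fun x y => ?_) hlW_symm (fun x => ?_) hlW_star ?_
    · change matrixForm re n μ (h (x * y)) = matrixForm re n μ (h (y * x))
      rw [map_mul h, map_mul h, matrixForm_mul_comm hq]
    · change matrixForm re n μ (h (sW x)) = matrixForm re n μ (h x)
      rw [hh, matrixForm_matrixConj hq]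
    · change matrixForm re n μ (h 1) = _
      rw [map_one, matrixForm_one hq, ← map_one π, hlW, mul_one, hμ, mul_div_cancel₀ _ hn0]
  have heq' : ∀ w, matrixForm re n μ (h w) = lW w := fun w => LinearMap.congr_fun heq w
  refine ⟨μ, h.toAlgHom.comp π, hn, fun hμ0 => ?_, h.surjective.comp hπ, fun b => ?_, fun b => ?_,
    fun b => ?_⟩
  -- If μ = 0, then l(eb) = 0 for all b, so e = 0 by non-degeneracy, although W ≠ 0.
  · have h0 : lW = 0 := by
      refine hW _ _ hlW_symm (by simp) hlW_star (by simp) ?_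
      rw [← map_one h.symm, ← heq', h.apply_symm_apply, matrixForm_one hq, hμ0, mul_zero]
      rfl
    have he0 : e = 0 := hls.nondeg e fun b => by rw [← hlW, h0]; rfl
    have h1 : π 1 = 0 := (hker 1).mpr (by rw [he0, zero_mul])
    rw [map_one] at h1
    exact one_ne_zero h1
  · rw [← hker]
    exact map_eq_zero_iff h h.injective
  · change h (π (s b)) = (matrixConj D n).baseChange ℂ (h (π b))
    rw [hs, hh]
  · change matrixForm re n μ (h (π b)) = _
    rw [heq', hlW]

variable {l : B →ₗ[ℂ] ℂ} {s : B →ₗ[ℂ] B}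

lemma IsStarForm.central_star (hls : IsStarForm l s) {e : B} (he : ∀ b, e * b = b * e) (b : B) :
    s e * b = b * s e := by
  rw [← hls.star_star b, ← hls.star_mul, ← hls.star_mul, he]

/-- Since s fixes e, it preserves the annihilator of e and induces an involution of the simple
quotient; the two classes of involutions give the models over ℝ and ℍ. -/
lemma hasModelCorner_of_fixed (hls : IsStarForm l s) {e : B} (he : ∀ b, e * b = b * e)
    (hes : s e = e) {N : ℕ} (hN : 0 < N) {π : B →ₐ[ℂ] Matrix (Fin N) (Fin N) ℂ}
    (hπ : Function.Surjective π) (hker : ∀ b, π b = 0 ↔ e * b = 0) : HasModelCorner l s e := by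
  obtain ⟨sec, hsec⟩ := π.toLinearMap.exists_rightInverse_of_surjective
    (LinearMap.range_eq_top.mpr hπ)
  have hsec' : ∀ w, π (sec w) = w := fun w => LinearMap.congr_fun hsec w
  let τ : Matrix (Fin N) (Fin N) ℂ →ₗ[ℂ] Matrix (Fin N) (Fin N) ℂ := π.toLinearMap ∘ₗ s ∘ₗ sec
  have hτ : ∀ b, π (s b) = τ (π b) := fun b => by
    change _ = π (s (sec (π b)))
    rw [← sub_eq_zero, ← map_sub, ← map_sub, hker, ← hes, hls.central_star he, ← hls.star_mul,
      (hker _).mp, map_zero]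
    rw [map_sub, hsec', sub_self]
  have hττ : ∀ x, τ (τ x) = x := fun x => by
    obtain ⟨x, rfl⟩ := hπ x
    rw [← hτ, ← hτ, hls.star_star]
  have hmul : ∀ x y, τ (x * y) = τ y * τ x := fun x y => by
    obtain ⟨x, rfl⟩ := hπ x
    obtain ⟨y, rfl⟩ := hπ y
    rw [← map_mul, ← hτ, ← hτ, ← hτ, hls.star_mul, map_mul]
  have : Nonempty (Fin N) := ⟨⟨0, hN⟩⟩
  rcases involution_classification hN τ hττ hmul with ⟨h, hh⟩ | ⟨n, hn, h, hh⟩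
  · obtain ⟨ρ, hρ⟩ := exists_realModelEquiv N
    obtain ⟨μ, g, hg⟩ := exists_form_eq hls he hes (hasUniqueForm_matrix τ) hπ hker hτ
      isUnitFrame_real hN (h.trans ρ.symm) fun w => ρ.injective (by simp [hρ, hh])
    exact ⟨.real, N, μ, g, hg⟩
  · obtain ⟨ρ, hρ⟩ := exists_quaternionModelEquiv n
    obtain ⟨μ, g, hg⟩ := exists_form_eq hls he hes (hasUniqueForm_matrix τ) hπ hker hτ
      isUnitFrame_quaternion hn (h.trans ρ.symm) fun w => ρ.injective (by simp [hρ, hh])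
    exact ⟨.quaternion, n, μ, g, hg⟩

/-- The corner of e + s(e) is the block together with its mirror image; an involution exchanging two
blocks carries no further invariant, so the model is the one over ℂ. -/
lemma hasModelCorner_of_swapped (hls : IsStarForm l s) {e : B} (he : ∀ b, e * b = b * e)
    (hee : e * e = e) (hes : e * s e = 0) {N : ℕ} (hN : 0 < N)
    {π : B →ₐ[ℂ] Matrix (Fin N) (Fin N) ℂ} (hπ : Function.Surjective π)
    (hker : ∀ b, π b = 0 ↔ e * b = 0) : HasModelCorner l s (e + s e) := by
  have : Nonempty (Fin N) := ⟨⟨0, hN⟩⟩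
  have hone : s 1 = 1 := by
    have := hls.star_mul (s 1) 1
    rw [mul_one, hls.star_star, mul_one] at this
    exact this.symm
  -- Transposition undoes the reversal of products by s, so this is a homomorphism; it gives the
  -- mirror block its coordinates.
  let π' : B →ₐ[ℂ] Matrix (Fin N) (Fin N) ℂ := AlgHom.ofLinearMap
    ((Matrix.transposeLinearEquiv _ _ ℂ ℂ).toLinearMap ∘ₗ π.toLinearMap ∘ₗ s)
    (by simp [hone]) (fun x y => by simp [hls.star_mul])
  have hπ' : ∀ b, π' b = (π (s b)).transpose := fun b => rfl
  let sW : Matrix (Fin N) (Fin N) ℂ × Matrix (Fin N) (Fin N) ℂ →ₗ[ℂ]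
      Matrix (Fin N) (Fin N) ℂ × Matrix (Fin N) (Fin N) ℂ :=
    ((Matrix.transposeLinearEquiv _ _ ℂ ℂ).toLinearMap ∘ₗ LinearMap.snd ℂ _ _).prod
      ((Matrix.transposeLinearEquiv _ _ ℂ ℂ).toLinearMap ∘ₗ LinearMap.fst ℂ _ _)
  have hsW : ∀ x, sW x = (x.2.transpose, x.1.transpose) := fun x => rfl
  have hπse : π (s e) = 0 := (hker _).mpr hes
  have hπe : π e = 1 := by
    rw [← sub_eq_zero, ← map_one π, ← map_sub, hker, mul_sub, hee, mul_one, sub_self]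
  have hsurj : Function.Surjective (π.prod π') := by
    rintro ⟨x, y⟩
    obtain ⟨a, rfl⟩ := hπ x
    obtain ⟨b, hb⟩ := hπ y.transpose
    refine ⟨e * a + s (e * b), ?_⟩
    refine Prod.ext ?_ ?_
    · change π _ = π a
      rw [map_add, hls.star_mul, map_mul, map_mul, hπse, hπe, mul_zero, add_zero, one_mul]
    · change π' _ = y
      rw [hπ', map_add, hls.star_star, hls.star_mul, map_add, map_mul, map_mul, hπse, hπe,
        mul_zero, zero_add, one_mul, hb, Matrix.transpose_transpose]
  have hcen : ∀ b, (e + s e) * b = b * (e + s e) := fun b => by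
    rw [add_mul, mul_add, he, hls.central_star he]
  have hker' : ∀ b, π.prod π' b = 0 ↔ (e + s e) * b = 0 := fun b => by
    have h1 : π.prod π' b = 0 ↔ e * b = 0 ∧ s e * b = 0 := by
      have h2 : π' b = 0 ↔ s e * b = 0 := by
        rw [hπ', Matrix.transpose_eq_zero, hker, hls.central_star he]
        constructor
        · intro h
          have := congrArg s h
          rwa [hls.star_mul, hls.star_star, map_zero] at this
        · intro h
          have := congrArg s h
          rwa [hls.star_mul, hls.star_star, map_zero] at this
      rw [← hker, ← h2]
      exact Prod.ext_iff
    rw [h1]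
    refine ⟨fun h => by rw [add_mul, h.1, h.2, add_zero], fun h => ?_⟩
    have h3 : e * b = 0 := by
      have := congrArg (e * ·) h
      simpa [← mul_assoc, mul_add, hee, hes] using this
    exact ⟨h3, by rwa [add_mul, h3, zero_add] at h⟩
  obtain ⟨ρ, hρ⟩ := exists_complexModelEquiv N
  obtain ⟨μ, g, hg⟩ := exists_form_eq hls hcen (by rw [map_add, hls.star_star, add_comm])
    (hasUniqueForm_prod sW hsW) hsurj hker'
    (fun b => by
      rw [hsW]
      refine Prod.ext ?_ ?_
      · change π (s b) = (π' b).transpose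
        rw [hπ', Matrix.transpose_transpose]
      · change π' (s b) = (π b).transpose
        rw [hπ', hls.star_star])
    isUnitFrame_complex hN ρ.symm fun w => ρ.injective (by rw [hρ]; simp [hsW])
  exact ⟨.complex, N, μ, g, hg⟩

/-- An algebra with a complete family of orthogonal model corners is a direct sum of models. -/
lemma exists_equiv_directSum {k : ℕ} {e : Fin k → B} (hc : ∀ i, HasModelCorner l s (e i))
    (hid : ∀ i, e i * e i = e i) (horth : ∀ i j, i ≠ j → e i * e j = 0)
    (hcomp : ∀ b, (∀ i, e i * b = 0) → b = 0) :
    ∃ (D : Fin k → DivisionType) (n : Fin k → ℕ) (μ : Fin k → ℂ)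
      (E : B ≃ₐ[ℂ] (EquippedData.directSum fun i => model (D i) (n i) (μ i)).B),
      (∀ i, 0 < n i ∧ μ i ≠ 0) ∧
      (∀ b, (EquippedData.directSum fun i => model (D i) (n i) (μ i)).lB (E b) = l b) ∧
      ∀ b, E (s b) = (EquippedData.directSum fun i => model (D i) (n i) (μ i)).starB (E b) := by
  choose D n μ g hn hμ hg hker hs hl using hc
  have hg1 : ∀ i, g i (e i) = 1 := fun i => by
    rw [← sub_eq_zero, ← map_one (g i), ← map_sub, hker, mul_sub, hid, mul_one, sub_self]
  have hg0 : ∀ i j, j ≠ i → g i (e j) = 0 := fun i j hij => (hker i _).mpr (horth i j hij.symm)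
  have hsum : ∑ i, e i = 1 := by
    rw [← sub_eq_zero]
    refine hcomp _ fun i => ?_
    rw [mul_sub, Finset.mul_sum, Finset.sum_eq_single i (fun j _ hj => horth i j hj.symm) (by simp),
      hid, mul_one, sub_self]
  have hbij : Function.Bijective (AlgHom.pi g) := by
    constructor
    · rw [injective_iff_map_eq_zero]
      exact fun b hb => hcomp b fun i => (hker i b).mp (congrFun hb i)
    · intro y
      choose c hc using fun i => hg i (y i)
      refine ⟨∑ j, e j * c j, funext fun i => ?_⟩
      rw [AlgHom.pi_apply, map_sum, Finset.sum_eq_single i]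
      · rw [map_mul, hg1, one_mul, hc]
      · intro j _ hj
        rw [map_mul, hg0 i j hj, zero_mul]
      · simp
  refine ⟨D, n, μ, AlgEquiv.ofBijective (AlgHom.pi g) hbij, fun i => ⟨hn i, hμ i⟩, fun b => ?_,
    fun b => funext fun i => hs i b⟩
  refine (pi_form_apply _ _).trans ?_
  refine (Finset.sum_congr rfl fun i _ => hl i b).trans ?_
  rw [← map_sum, ← Finset.sum_mul, hsum, one_mul]

end Corners

/-! ### Blocks of a semi-simple algebra and their permutation by ⋆ -/

section Blocks

lemma exists_scalar_eq {ι : Type*} [Fintype ι] [DecidableEq ι] {Z : Matrix ι ι ℂ}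
    (h : ∀ x, Z * x = x * Z) : ∃ c : ℂ, Z = c • 1 := by
  have hc : Z ∈ Set.center (Matrix ι ι ℂ) := Semigroup.mem_center_iff.mpr fun x => (h x).symm
  rw [Matrix.center_eq_range] at hc
  obtain ⟨c, rfl⟩ := hc
  exact ⟨c, (Matrix.smul_one_eq_diagonal c).symm⟩

variable {B : Type*} [Ring B] [Algebra ℂ B] {m : ℕ} {d : Fin m → ℕ}
  (E : B ≃ₐ[ℂ] ∀ i, Matrix (Fin (d i)) (Fin (d i)) ℂ)

/-- The projection onto a block. -/
def blockProj (i : Fin m) : B →ₐ[ℂ] Matrix (Fin (d i)) (Fin (d i)) ℂ :=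
  (Pi.evalAlgHom ℂ _ i).comp E.toAlgHom

/-- The unit of a block. -/
def blockUnit (i : Fin m) : B := E.symm (Pi.single i 1)

lemma blockProj_apply (i : Fin m) (b : B) : blockProj E i b = E b i := rfl

lemma map_blockUnit_mul (i : Fin m) (b : B) : E (blockUnit E i * b) = Pi.single i (E b i) := by
  rw [map_mul, blockUnit, E.apply_symm_apply, single_mul_eq, one_mul]

lemma map_mul_blockUnit (i : Fin m) (b : B) : E (b * blockUnit E i) = Pi.single i (E b i) := by
  rw [map_mul, blockUnit, E.apply_symm_apply]
  ext1 j
  by_cases h : j = i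
  · subst h; simp
  · simp [Pi.single_eq_of_ne h]

lemma blockUnit_central (i : Fin m) (b : B) : blockUnit E i * b = b * blockUnit E i :=
  E.injective (by rw [map_blockUnit_mul, map_mul_blockUnit])

lemma blockProj_surjective (i : Fin m) : Function.Surjective (blockProj E i) := fun x =>
  ⟨E.symm (Pi.single i x), by rw [blockProj_apply, E.apply_symm_apply, Pi.single_eq_same]⟩

lemma blockProj_eq_zero_iff (i : Fin m) (b : B) :
    blockProj E i b = 0 ↔ blockUnit E i * b = 0 := by
  rw [← map_eq_zero_iff E E.injective, map_blockUnit_mul, blockProj_apply, Pi.single_eq_zero_iff]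

lemma blockUnit_mul_self (i : Fin m) : blockUnit E i * blockUnit E i = blockUnit E i :=
  E.injective (by
    rw [map_blockUnit_mul, blockUnit, E.apply_symm_apply, Pi.single_eq_same])

lemma blockUnit_mul_of_ne {i j : Fin m} (h : i ≠ j) : blockUnit E i * blockUnit E j = 0 :=
  E.injective (by
    rw [map_blockUnit_mul, blockUnit, E.apply_symm_apply, Pi.single_eq_of_ne h, Pi.single_zero,
      map_zero])

lemma eq_zero_of_blockUnit_mul {b : B} (h : ∀ i, blockUnit E i * b = 0) : b = 0 :=
  E.injective (by
    rw [map_zero]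
    exact funext fun i => (blockProj_eq_zero_iff E i b).mpr (h i))

lemma blockUnit_ne_zero [∀ i, NeZero (d i)] (i : Fin m) : blockUnit E i ≠ 0 := by
  rw [blockUnit, Ne, map_eq_zero_iff _ E.symm.injective, Pi.single_eq_zero_iff]
  exact one_ne_zero

lemma blockUnit_injective [∀ i, NeZero (d i)] : Function.Injective (blockUnit E) := by
  intro i j h
  by_contra hij
  have := blockUnit_mul_of_ne E hij
  rw [← h, blockUnit_mul_self] at this
  exact blockUnit_ne_zero E i this

/-- The blocks are minimal: a central idempotent contains a block or is orthogonal to it. -/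
lemma blockUnit_mul_eq_zero_or (i : Fin m) {z : B} (hz : ∀ b, z * b = b * z) (hzz : z * z = z) :
    blockUnit E i * z = 0 ∨ blockUnit E i * z = blockUnit E i := by
  obtain ⟨c, hc⟩ := exists_scalar_eq (Z := blockProj E i z) fun x => by
    obtain ⟨x, rfl⟩ := blockProj_surjective E i x
    rw [← map_mul, ← map_mul, hz]
  have h1 : blockProj E i z * blockProj E i z = blockProj E i z := by rw [← map_mul, hzz]
  rw [← blockProj_eq_zero_iff]
  have h2 : blockProj E i z = 1 → blockUnit E i * z = blockUnit E i := fun h => by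
    rw [← sub_eq_zero, ← mul_one (blockUnit E i), mul_assoc, one_mul, ← mul_sub,
      ← blockProj_eq_zero_iff, map_sub, h, map_one, sub_self]
  rcases isEmpty_or_nonempty (Fin (d i)) with h | h
  · exact Or.inl (Subsingleton.elim _ _)
  · rw [hc, smul_mul_smul_comm, mul_one] at h1
    have h3 : c * c = c := by
      have := congrFun (congrFun h1 h.some) h.some
      simpa using this
    rcases eq_or_ne c 0 with h4 | h4
    · left; rw [hc, h4, zero_smul]
    · right; exact h2 (by rw [hc, mul_left_cancel₀ h4 (h3.trans (mul_one c).symm), one_smul])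

variable {l : B →ₗ[ℂ] ℂ} {s : B →ₗ[ℂ] B}

/-- An involution permutes the blocks. -/
lemma exists_star_blockUnit [∀ i, NeZero (d i)] (hls : IsStarForm l s) (i : Fin m) :
    ∃ j, s (blockUnit E i) = blockUnit E j := by
  have hcen := fun i => hls.central_star (blockUnit_central E i)
  have hid : ∀ i, s (blockUnit E i) * s (blockUnit E i) = s (blockUnit E i) := fun i => by
    rw [← hls.star_mul, blockUnit_mul_self]
  have hne : ∀ i, s (blockUnit E i) ≠ 0 := fun i h => by
    have := hls.star_star (blockUnit E i)
    rw [h, map_zero] at this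
    exact blockUnit_ne_zero E i this.symm
  obtain ⟨j, hj⟩ : ∃ j, blockUnit E j * s (blockUnit E i) ≠ 0 := by
    by_contra! h
    exact hne i (eq_zero_of_blockUnit_mul E h)
  -- Minimality of block j puts uⱼ below s(uᵢ). Applying s puts s(uⱼ) below uᵢ, and minimality of
  -- block i gives equality.
  have h1 := (blockUnit_mul_eq_zero_or E j (hcen i) (hid i)).resolve_left hj
  have h2 : blockUnit E i * s (blockUnit E j) = s (blockUnit E j) := by
    have := congrArg s h1
    rwa [hls.star_mul, hls.star_star] at this
  have h3 := (blockUnit_mul_eq_zero_or E i (hcen j) (hid j)).resolve_left (by rw [h2]; exact hne j)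
  exact ⟨j, by rw [← h3, h2, hls.star_star]⟩

/-- A semi-simple complex algebra with an involution and an invariant symmetric form is a direct
sum of models. -/
theorem exists_model_decomposition [∀ i, NeZero (d i)]
    (E : B ≃ₐ[ℂ] ∀ i, Matrix (Fin (d i)) (Fin (d i)) ℂ) (hls : IsStarForm l s) :
    ∃ (k : ℕ) (D : Fin k → DivisionType) (n : Fin k → ℕ) (μ : Fin k → ℂ)
      (f : B ≃ₐ[ℂ] (EquippedData.directSum fun i => model (D i) (n i) (μ i)).B),
      (∀ i, 0 < n i ∧ μ i ≠ 0) ∧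
      (∀ b, (EquippedData.directSum fun i => model (D i) (n i) (μ i)).lB (f b) = l b) ∧
      ∀ b, f (s b) = (EquippedData.directSum fun i => model (D i) (n i) (μ i)).starB (f b) := by
  choose σ hσ using fun i => exists_star_blockUnit E hls i
  have hσσ : ∀ i, σ (σ i) = i := fun i =>
    blockUnit_injective E (by rw [← hσ, ← hσ, hls.star_star])
  -- One idempotent for each orbit of σ, indexed by the smaller element of the orbit.
  let e : {t : Fin m // t ≤ σ t} → B := fun t =>
    if σ t = t then blockUnit E t else blockUnit E t + blockUnit E (σ t)
  have hmul : ∀ t, blockUnit E t.1 * e t = blockUnit E t.1 := fun t => by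
    simp only [e]
    split_ifs with h
    · rw [blockUnit_mul_self]
    · rw [mul_add, blockUnit_mul_self, blockUnit_mul_of_ne E (Ne.symm h), add_zero]
  have hmul' : ∀ t, blockUnit E (σ t.1) * e t = blockUnit E (σ t.1) := fun t => by
    simp only [e]
    split_ifs with h
    · rw [h, blockUnit_mul_self]
    · rw [mul_add, blockUnit_mul_self, blockUnit_mul_of_ne E h, zero_add]
  have hid : ∀ t, e t * e t = e t := fun t => by
    conv_lhs => enter [1]; simp only [e]
    split_ifs with h
    · rw [hmul]; simp only [e]; rw [if_pos h]
    · rw [add_mul, hmul, hmul']; simp only [e]; rw [if_neg h]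
  have horth : ∀ t t', t ≠ t' → e t * e t' = 0 := fun t t' htt' => by
    have h1 : t.1 ≠ t'.1 := fun h => htt' (Subtype.ext h)
    have h2 : σ t.1 ≠ σ t'.1 := fun h => h1 (by rw [← hσσ t.1, h, hσσ])
    have h3 : t.1 ≠ σ t'.1 := fun h => h1 (le_antisymm
      (by have := t.2; rwa [h, hσσ, ← h] at this) (h ▸ t'.2))
    have h4 : σ t.1 ≠ t'.1 := fun h => h3 (by rw [← h, hσσ])
    simp only [e]
    split_ifs <;> simp [mul_add, add_mul, blockUnit_mul_of_ne E h1, blockUnit_mul_of_ne E h2,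
      blockUnit_mul_of_ne E h3, blockUnit_mul_of_ne E h4]
  have hcomp : ∀ b, (∀ t, e t * b = 0) → b = 0 := fun b hb => by
    refine eq_zero_of_blockUnit_mul E fun i => ?_
    rcases le_total i (σ i) with h | h
    · rw [← hmul ⟨i, h⟩, mul_assoc, hb, mul_zero]
    · have := hmul' ⟨σ i, by rwa [hσσ]⟩
      simp only [hσσ] at this
      rw [← this, mul_assoc, hb, mul_zero]
  have hcorner : ∀ t, HasModelCorner l s (e t) := fun t => by
    have hpos : 0 < d t.1 := Nat.pos_of_ne_zero (NeZero.ne _)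
    by_cases h : σ t.1 = t.1
    · have he : e t = blockUnit E t.1 := if_pos h
      rw [he]
      exact hasModelCorner_of_fixed hls (blockUnit_central E _) (by rw [hσ, h]) hpos
        (blockProj_surjective E _) (blockProj_eq_zero_iff E _)
    · have he : e t = blockUnit E t.1 + s (blockUnit E t.1) := by rw [hσ]; exact if_neg h
      rw [he]
      exact hasModelCorner_of_swapped hls (blockUnit_central E _) (blockUnit_mul_self E _)
        (by rw [hσ, blockUnit_mul_of_ne E (Ne.symm h)]) hpos
        (blockProj_surjective E _) (blockProj_eq_zero_iff E _)
  let v := Fintype.equivFin {t : Fin m // t ≤ σ t}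
  exact ⟨_, exists_equiv_directSum (e := fun i => e (v.symm i)) (fun i => hcorner _)
    (fun i => hid _) (fun i j hij => horth _ _ fun h => hij (v.symm.injective h))
    fun b hb => hcomp b fun t => by simpa using hb (v t)⟩

lemma isDualFamily_trace {ι : Type*} [Fintype ι] [DecidableEq ι] {l : Matrix ι ι ℂ →ₗ[ℂ] ℂ} {c : ℂ}
    (hl : ∀ x, l x = c * x.trace) (hc : c ≠ 0) :
    IsDualFamily l (fun p : ι × ι => Matrix.single p.1 p.2 1)
      (fun p => Matrix.single p.2 p.1 c⁻¹) := by
  intro v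
  rw [Fintype.sum_prod_type]
  conv_rhs => rw [Matrix.matrix_eq_sum_single v]
  refine Finset.sum_congr rfl fun i _ => Finset.sum_congr rfl fun j _ => ?_
  rw [hl, Matrix.trace_single_mul, Matrix.smul_single, smul_eq_mul, smul_eq_mul, mul_one,
    mul_inv_cancel_left₀ hc]

lemma average_trace {ι : Type*} [Fintype ι] [DecidableEq ι] (c : ℂ) (b : Matrix ι ι ℂ) :
    ∑ p : ι × ι, Matrix.single p.2 p.1 c⁻¹ * b * Matrix.single p.1 p.2 1 =
      (c⁻¹ * b.trace) • (1 : Matrix ι ι ℂ) := by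
  simp only [Matrix.single_mul_mul_single, mul_one]
  rw [Fintype.sum_prod_type_right, Matrix.smul_one_eq_diagonal]
  ext i j
  simp only [Matrix.sum_apply, Matrix.single_apply, Matrix.diagonal_apply, Matrix.trace,
    Finset.mul_sum, Matrix.diag_apply]
  by_cases h : i = j
  · subst h
    simp
  · rw [if_neg h]
    refine Finset.sum_eq_zero fun a _ => Finset.sum_eq_zero fun b _ => if_neg ?_
    rintro ⟨rfl, rfl⟩
    exact h rfl

/-- On block i the form is cᵢ tr with cᵢ ≠ 0, and averaging over matrix units sends b to cᵢ⁻¹ tr(bᵢ)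
· 1, so every scalar arises. Independence of the dual families carries this over to x, y. -/
lemma centerEqAverages_of_blocks [∀ i, NeZero (d i)]
    (E : B ≃ₐ[ℂ] ∀ i, Matrix (Fin (d i)) (Fin (d i)) ℂ) (hsymm : ∀ x y, l (x * y) = l (y * x))
    (hl : ∀ x, (∀ y, l (x * y) = 0) → x = 0) : CenterEqAverages ℂ l := by
  intro κ _ x y hxy z hz
  let L : ∀ i, Matrix (Fin (d i)) (Fin (d i)) ℂ →ₗ[ℂ] ℂ := fun i =>
    l ∘ₗ E.symm.toLinearMap ∘ₗ
      LinearMap.single ℂ (fun i => Matrix (Fin (d i)) (Fin (d i)) ℂ) i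
  have hL : ∀ i X, L i X = l (E.symm (Pi.single i X)) := fun i X => rfl
  have hLsymm : ∀ i X Y, L i (X * Y) = L i (Y * X) := fun i X Y => by
    rw [hL, hL, Pi.single_mul, Pi.single_mul, map_mul E.symm, map_mul E.symm, hsymm]
  choose c hc using fun i => exists_eq_smul_trace (L i) (hLsymm i)
  have hc0 : ∀ i, c i ≠ 0 := fun i h0 => blockUnit_ne_zero E i <| hl _ fun b => by
    have h1 : blockUnit E i * b = E.symm (Pi.single i (E b i)) := by
      rw [← map_blockUnit_mul, E.symm_apply_apply]
    rw [h1, ← hL, hc, h0, zero_mul]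
  have hdual := (IsDualFamily.pi fun i => isDualFamily_trace (hc i) (hc0 i)).map E.symm (l' := l)
    fun v => by
      rw [pi_form_apply]
      simp only [hL]
      rw [← map_sum, ← map_sum, Finset.univ_sum_single]
  choose a ha using fun i => exists_scalar_eq (Z := E z i) fun X => by
    obtain ⟨X, rfl⟩ := blockProj_surjective E i X
    have := congrArg (blockProj E i) (hz X)
    rwa [map_mul, map_mul] at this
  -- Any b whose i-th block has trace cᵢ aᵢ would do, where z acts on block i as aᵢ.
  refine ⟨E.symm fun i => Matrix.single 0 0 (c i * a i), ?_⟩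
  set b := E.symm fun i => Matrix.single 0 0 (c i * a i) with hb
  -- The bilinear map is (u, v) ↦ v b u.
  have h1 := hxy.sum_eq hl hdual ((LinearMap.mul ℂ B).flip.compl₂ (LinearMap.mulRight ℂ b))
  refine h1.trans (E.injective ?_)
  have h2 : ∀ p : Σ i, Fin (d i) × Fin (d i),
      E (((LinearMap.mul ℂ B).flip.compl₂ (LinearMap.mulRight ℂ b))
        (E.symm (Pi.single p.1 (Matrix.single p.2.1 p.2.2 1)))
        (E.symm (Pi.single p.1 (Matrix.single p.2.2 p.2.1 (c p.1)⁻¹)))) =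
      Pi.single p.1 (Matrix.single p.2.2 p.2.1 (c p.1)⁻¹) * E b *
        Pi.single p.1 (Matrix.single p.2.1 p.2.2 1) := fun p => by
    simp
  rw [map_sum]
  refine (Finset.sum_congr rfl fun p _ => h2 p).trans ?_
  refine (pi_average (fun i (p : Fin (d i) × Fin (d i)) => Matrix.single p.1 p.2 1)
    (fun i (p : Fin (d i) × Fin (d i)) => Matrix.single p.2 p.1 (c i)⁻¹) (E b)).trans ?_
  funext i
  rw [average_trace, ha, hb, E.apply_symm_apply, Matrix.trace_single_eq_same,
    inv_mul_cancel_left₀ (hc0 i)]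

end Blocks

/-! ### Split real forms and pseudoreality -/

section RealForms

/-- A block of size at least 2 would contain E_aa and E_ab with a ≠ b, which do not commute. -/
lemma exists_algEquiv_pi_of_comm {A : Type*} [CommRing A] [Algebra ℂ A] [Module.Finite ℂ A]
    [IsSemisimpleRing A] : ∃ p : ℕ, Nonempty (A ≃ₐ[ℂ] (Fin p → ℂ)) := by
  obtain ⟨p, d, hd, ⟨E⟩⟩ := IsSemisimpleRing.exists_algEquiv_pi_matrix_of_isAlgClosed ℂ A
  have hsub : ∀ i, Subsingleton (Fin (d i)) := fun i => by
    refine ⟨fun a b => ?_⟩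
    by_contra hab
    obtain ⟨x, hx⟩ := blockProj_surjective E i (Matrix.single a a 1)
    obtain ⟨y, hy⟩ := blockProj_surjective E i (Matrix.single a b 1)
    have h := congrArg (blockProj E i) (mul_comm x y)
    rw [map_mul, map_mul, hx, hy, Matrix.single_mul_single_same,
      Matrix.single_mul_single_of_ne _ _ _ _ (Ne.symm hab)] at h
    have := congrFun (congrFun h a) b
    simp at this
  let f : (Fin p → ℂ) →ₐ[ℂ] ∀ i, Matrix (Fin (d i)) (Fin (d i)) ℂ :=
    AlgHom.pi fun i => (Algebra.ofId ℂ _).comp (Pi.evalAlgHom ℂ _ i)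
  have hf : ∀ v i, f v i 0 0 = v i := fun v i => by
    change algebraMap ℂ (Matrix (Fin (d i)) (Fin (d i)) ℂ) (v i) 0 0 = v i
    rw [Matrix.algebraMap_matrix_apply, if_pos rfl]
    rfl
  have hbij : Function.Bijective f := by
    constructor
    · intro v w h
      exact funext fun i => by rw [← hf v, ← hf w, h]
    · intro X
      refine ⟨fun i => X i 0 0, funext fun i => Matrix.ext fun a b => ?_⟩
      rw [Subsingleton.elim a 0, Subsingleton.elim b 0, hf]
  exact ⟨p, ⟨E.trans (AlgEquiv.ofBijective f hbij).symm⟩⟩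

/-- A central homomorphism from `ℂᵖ` to a product of matrix algebras is a selection of
coordinates. -/
lemma exists_central_hom_eq {A B : Type*} [CommRing A] [Algebra ℂ A] [Ring B] [Algebra ℂ B]
    {p m : ℕ} {d : Fin m → ℕ} [∀ i, NeZero (d i)] (EA : A ≃ₐ[ℂ] (Fin p → ℂ))
    (EB : B ≃ₐ[ℂ] ∀ i, Matrix (Fin (d i)) (Fin (d i)) ℂ) (φ : A →ₐ[ℂ] B)
    (hφ : ∀ a b, φ a * b = b * φ a) :
    ∃ σ : Fin m → Fin p, ∀ a j, EB (φ a) j = EA a (σ j) • 1 := by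
  have key : ∀ j, ∃ i, ∀ a, EB (φ a) j = EA a i • 1 := fun j => by
    let g : A →ₐ[ℂ] Matrix (Fin (d j)) (Fin (d j)) ℂ := (blockProj EB j).comp φ
    -- The coordinate idempotents sum to 1, so g cannot kill all of them. One with non-zero, hence
    -- scalar, image detects the coordinate through which g factors.
    obtain ⟨i, hi⟩ : ∃ i, g (EA.symm (Pi.single i 1)) ≠ 0 := by
      by_contra! h
      have h1 : g 1 = 0 := by
        rw [← map_one EA.symm, ← Finset.univ_sum_single (1 : Fin p → ℂ), map_sum, map_sum]
        exact Finset.sum_eq_zero fun i _ => h i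
      rw [map_one] at h1
      exact one_ne_zero h1
    obtain ⟨c, hc⟩ := exists_scalar_eq (Z := g (EA.symm (Pi.single i 1))) fun X => by
      obtain ⟨X, rfl⟩ := blockProj_surjective EB j X
      have := congrArg (blockProj EB j) (hφ (EA.symm (Pi.single i 1)) X)
      rwa [map_mul, map_mul] at this
    have hc0 : c ≠ 0 := by
      rintro rfl
      exact hi (by rw [hc, zero_smul])
    refine ⟨i, fun a => ?_⟩
    have h1 : a * EA.symm (Pi.single i 1) = EA a i • EA.symm (Pi.single i 1) := EA.injective (by
      rw [map_mul, map_smul, EA.apply_symm_apply, mul_comm, single_mul_eq, one_mul]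
      ext1 k
      by_cases hk : k = i
      · subst hk; simp
      · simp [Pi.single_eq_of_ne hk])
    have h2 := congrArg g h1
    rw [map_mul, map_smul, hc, smul_comm, mul_smul_comm, mul_one] at h2
    have h3 := congrArg (c⁻¹ • ·) h2
    simp only [inv_smul_smul₀ hc0] at h3
    exact h3
  choose σ hσ using key
  exact ⟨σ, fun a j => hσ j a⟩

lemma span_range_compLeft (p : ℕ) :
    Submodule.span ℂ (Set.range ((Algebra.ofId ℝ ℂ).compLeft (Fin p))) = ⊤ := by
  rw [eq_top_iff]
  intro v _
  rw [← Finset.univ_sum_single v]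
  refine Submodule.sum_mem _ fun i _ => ?_
  have h : (Pi.single i (v i) : Fin p → ℂ) =
      v i • (Algebra.ofId ℝ ℂ).compLeft (Fin p) (Pi.single i 1) := by
    ext1 j
    by_cases hj : j = i
    · subst hj; simp
    · simp [Pi.single_eq_of_ne hj]
  rw [h]
  exact Submodule.smul_mem _ _ (Submodule.subset_span ⟨_, rfl⟩)

/-- The inclusion of a product of real matrix algebras into its complexification. -/
def realMatrices {m : ℕ} (d : Fin m → ℕ) : (∀ i, Matrix (Fin (d i)) (Fin (d i)) ℝ) →ₐ[ℝ]
    ∀ i, Matrix (Fin (d i)) (Fin (d i)) ℂ :=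
  AlgHom.pi fun i => (Algebra.ofId ℝ ℂ).mapMatrix.comp (Pi.evalAlgHom ℝ _ i)

lemma span_range_realMatrices {m : ℕ} (d : Fin m → ℕ) :
    Submodule.span ℂ (Set.range (realMatrices d)) = ⊤ := by
  rw [eq_top_iff]
  intro v _
  rw [← Finset.univ_sum_single v]
  refine Submodule.sum_mem _ fun i _ => ?_
  rw [Matrix.matrix_eq_sum_single (v i)]
  have h : Pi.single i (∑ a, ∑ b, Matrix.single a b (v i a b)) =
      ∑ a, ∑ b, v i a b • realMatrices d (Pi.single i (Matrix.single a b 1)) := by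
    ext1 j
    simp only [Finset.sum_apply]
    by_cases hj : j = i
    · subst hj
      simp only [Pi.single_eq_same, Pi.smul_apply]
      refine Finset.sum_congr rfl fun a _ => Finset.sum_congr rfl fun b _ => ?_
      simp [realMatrices]
    · rw [Pi.single_eq_of_ne hj]
      refine (Finset.sum_eq_zero fun a _ => Finset.sum_eq_zero fun b _ => ?_).symm
      have h0 : (Pi.single i (Matrix.single a b 1) : ∀ i, Matrix (Fin (d i)) (Fin (d i)) ℝ) j = 0 :=
        Pi.single_eq_of_ne hj _
      change v i a b • Matrix.map ((Pi.single i (Matrix.single a b 1) :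
        ∀ i, Matrix (Fin (d i)) (Fin (d i)) ℝ) j) (algebraMap ℝ ℂ) = 0
      rw [h0, Matrix.map_zero _ (map_zero _), smul_zero]
  rw [h]
  exact Submodule.sum_mem _ fun a _ => Submodule.sum_mem _ fun b _ =>
    Submodule.smul_mem _ _ (Submodule.subset_span ⟨_, rfl⟩)

/-- The complexification of the lift of a real algebra to a higher universe. -/
def complexificationUlift {V : Type*} {W : Type*} [Ring V] [Algebra ℝ V] [Module.Finite ℝ V]
    [Ring W] [Algebra ℂ W] [Algebra ℝ W] [@IsScalarTower ℝ ℂ W _ _ Algebra.toSMul]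
    [Module.Finite ℂ W] (f : V →ₐ[ℝ] W) (hspan : Submodule.span ℂ (Set.range f) = ⊤)
    (hrank : Module.finrank ℝ V = Module.finrank ℂ W) : ℂ ⊗[ℝ] ULift.{u} V ≃ₐ[ℂ] W :=
  (Algebra.TensorProduct.congr AlgEquiv.refl ULift.algEquiv).trans
    (AlgEquiv.ofBijective _ (liftEquiv_bijective f hspan hrank))

/-- Semi-simple algebras are pseudoreal, simple or not: `φ` maps the primitive idempotents of
`A ≅ ℂᵖ` to sums of unit matrices of blocks of `B`, hence is defined over `ℝ` for the split real forms
`ℝᵖ` and `∏ Mat(ℝ)`. -/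
theorem EquippedCFAlgebra.IsSemisimple.isPseudoreal {H : EquippedCFAlgebra.{u, v, 0} ℂ}
    (hH : H.IsSemisimple) : H.IsPseudoreal := by
  have := hH.semisimpleA
  have := hH.semisimpleB
  obtain ⟨p, ⟨EA⟩⟩ := exists_algEquiv_pi_of_comm (A := H.A)
  obtain ⟨m, d, _, ⟨EB⟩⟩ := IsSemisimpleRing.exists_algEquiv_pi_matrix_of_isAlgClosed ℂ H.B
  obtain ⟨σ, hσ⟩ := exists_central_hom_eq EA EB H.φ H.central
  let φR : (Fin p → ℝ) →ₐ[ℝ] ∀ i, Matrix (Fin (d i)) (Fin (d i)) ℝ :=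
    AlgHom.pi fun j => (Algebra.ofId ℝ _).comp (Pi.evalAlgHom ℝ _ (σ j))
  refine ⟨ULift.{u} (Fin p → ℝ), ULift.{v} (∀ i, Matrix (Fin (d i)) (Fin (d i)) ℝ),
    inferInstance, inferInstance, inferInstance, inferInstance,
    (ULift.algEquiv.symm.toAlgHom.comp φR).comp ULift.algEquiv.toAlgHom,
    (complexificationUlift _ (span_range_compLeft p) (by simp)).trans EA.symm,
    (complexificationUlift _ (span_range_realMatrices d)
      (by simp [Module.finrank_pi_fintype, Module.finrank_matrix])).trans EB.symm, fun x => ?_⟩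
  induction x with
  | zero => simp
  | add x y hx hy => simp only [map_add, hx, hy]
  | tmul z r =>
    apply EB.injective
    funext j
    rw [hσ]
    simp only [AlgEquiv.trans_apply, AlgEquiv.apply_symm_apply]
    change (z * (r.down (σ j) : ℂ)) • (1 : Matrix (Fin (d j)) (Fin (d j)) ℂ) =
      z • (algebraMap ℝ (Matrix (Fin (d j)) (Fin (d j)) ℝ) (r.down (σ j))).map (algebraMap ℝ ℂ)
    rw [mul_smul]
    congr 1
    ext a b
    simp [Matrix.algebraMap_matrix_apply, Matrix.one_apply]
    split_ifs <;> simp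

end RealForms

end CardyFrobenius

end

theorem mainTheorem2 (H : CardyFrobenius.EquippedCFAlgebra.{u, v, 0} ℂ) (hH : H.IsSemisimple) :
    (∃ (k : ℕ) (D : Fin k → CardyFrobenius.DivisionType) (n : Fin k → ℕ) (μ : Fin k → ℂ)
        (f : H.toEquippedData.Iso
          ((CardyFrobenius.EquippedData.directSum
            fun i => CardyFrobenius.model (D i) (n i) (μ i)).prod (H.kernelSummand hH))),
        (∀ i, 0 < n i ∧ μ i ≠ 0) ∧
          ∀ x : H.Ker, f.equivA (H.kerIncl x) = (0, x)) ∧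
      (H.IsSimple → H.IsPseudoreal) := by
  refine ⟨?_, fun _ => hH.isPseudoreal⟩
  have := hH.semisimpleB
  obtain ⟨m, d, _, ⟨E⟩⟩ := IsSemisimpleRing.exists_algEquiv_pi_matrix_of_isAlgClosed ℂ H.B
  obtain ⟨k, D, n, μ, e, hpos, hl, hs⟩ := CardyFrobenius.exists_model_decomposition E
    (l := H.lB) (s := H.starB) ⟨H.symmB, H.nondegB, H.starB_starB, H.starB_mul, H.lB_star⟩
  obtain ⟨f, hf⟩ := CardyFrobenius.EquippedCFAlgebra.exists_iso_prod_kernelSummand hH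
    (CardyFrobenius.centerEqAverages_of_blocks E H.symmB H.nondegB)
    (CardyFrobenius.EquippedData.IsCentral.directSum fun i =>
      CardyFrobenius.model_isCentral (D i) (hpos i).1 (hpos i).2) e hl hs
  exact ⟨k, D, n, μ, f, hpos, hf⟩
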